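/- Let $n\ge 1$ and let $M$ be a connected oriented smooth $n$-manifold, let $\phi: M\to\mathbb{S}^{n+1}\subset\mathbb{R}^{n+2}$ be a smooth immersion into the unit sphere such that $M$ is complete for the metric induced by $\phi$, and let $\nu: M\to\mathbb{S}^{n+1}\subset\mathbb{R}^{n+2}$ be a Gauss map of $\phi$, i.e. a smooth field of unit vectors such that $\nu(x)$ is orthogonal to $\phi(x)$ and to $d\phi_x(T_xM)$ for every $x\in M$. Let $A_x: T_xM\to T_xM$, defined by $d\phi_x(A_xw)=-d\nu_x(w)$, be the shape operator, and suppose that the mean curvature $H(x)=\frac1n\operatorname{trace}A_x$ is constant on $M$. For $v\in\mathbb{R}^{n+2}$ let $\ell_v(x)=\langle\phi(x),v\rangle$ and $f_v(x)=\langle\nu(x),v\rangle$. Suppose that $\ell_v=\lambda f_v$ on $M$ for some nonzero vector $v\in\mathbb{R}^{n+2}$ and some $\lambda\in\mathbb{R}$. Then $\phi(M)$ is one of the following: (i) a totally umbilical sphere, i.e. $\phi(M)=\{p\in\mathbb{S}^{n+1}:\langle p,u\rangle=c\}$ for some unit vector $u\in\mathbb{R}^{n+2}$ and some $c\in\mathbb{R}$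 with $|c|<1$; or (ii) a Clifford hypersurface, i.e. there are $k\in\{1,\dots,n-1\}$, $r\in(0,1)$ and a linear isometry $g$ of $\mathbb{R}^{n+2}$ such that $\phi(M)=g(M_k(r))$, where $M_k(r)=\mathbb{S}^{k}(r)\times\mathbb{S}^{n-k}(\sqrt{1-r^2})=\{(x,y)\in\mathbb{R}^{k+1}\times\mathbb{R}^{n-k+1}:\|x\|^2=r^2,\ \|y\|^2=1-r^2\}$. -/

import Mathlib

open scoped Manifold ContDiff Bundle EuclideanSpace RealInnerProductSpace

noncomputable section

/-- The Euclidean space `ℝ^(n+2)`, in which the unit sphere `S^(n+1)` lies. -/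
abbrev Ambient (n : ℕ) : Type := EuclideanSpace ℝ (Fin (n + 2))

/-- The unit sphere `S^(n+1)` of `ℝ^(n+2)`, with its standard smooth structure. -/
abbrev UnitSphere (n : ℕ) : Type := Metric.sphere (0 : Ambient n) 1

section Hypersurface

variable {n : ℕ} {M : Type*} [TopologicalSpace M] [ChartedSpace (EuclideanSpace ℝ (Fin n)) M]

/-- The map `φ : M → S^(n+1)`, regarded as a map into `ℝ^(n+2)`. -/
def position (φ : M → UnitSphere n) (x : M) : Ambient n := (φ x : Ambient n)

/-- The differential `dφ_x : T_x M → ℝ^(n+2)` of `φ : M → S^(n+1) ⊆ ℝ^(n+2)`. -/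
def dPosition (φ : M → UnitSphere n) (x : M) : TangentSpace (𝓡 n) x →L[ℝ] Ambient n :=
  mvfderiv (𝓡 n) (position φ) x

/-- `ν` is a Gauss map of the hypersurface `φ : M → S^(n+1)`: a smooth field of unit vectors of
`ℝ^(n+2)` along `φ` which at each `x` is orthogonal to `φ x` and to `dφ_x (T_x M)`. As `S^(n+1)` is
oriented, a choice of `ν` is the same as a choice of an orientation of `M`. -/
structure IsGaussMap (φ : M → UnitSphere n) (ν : M → Ambient n) : Prop where
  smooth : ContMDiff (𝓡 n) 𝓘(ℝ, Ambient n) ∞ ν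
  norm_eq_one : ∀ x, ‖ν x‖ = 1
  inner_position : ∀ x, ⟪ν x, position φ x⟫ = 0
  inner_tangent : ∀ x (w : TangentSpace (𝓡 n) x), ⟪ν x, dPosition φ x w⟫ = 0

/-- The shape operator `A_x : T_x M → T_x M`, given by `A_x w = -dν_x w`, where `T_x M` is
identified with `dφ_x (T_x M)` by the injective map `dφ_x`. For an immersion `φ` with Gauss map `ν`
the vector `dν_x w` lies in `dφ_x (T_x M)`, so the choice of the left inverse of `dφ_x` does not
matter: `A_x w` is the only vector with `dφ_x (A_x w) = -dν_x w`. -/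
def shapeOperator (φ : M → UnitSphere n) (ν : M → Ambient n) (x : M) :
    TangentSpace (𝓡 n) x →ₗ[ℝ] TangentSpace (𝓡 n) x :=
  -((dPosition φ x).toLinearMap.leftInverse ∘ₗ (mvfderiv (𝓡 n) ν x).toLinearMap)

/-- The mean curvature: the average of the `n` principal curvatures, i.e. of the eigenvalues of the
shape operator counted with multiplicity. -/
def meanCurvature (φ : M → UnitSphere n) (ν : M → Ambient n) (x : M) : ℝ :=
  LinearMap.trace ℝ (TangentSpace (𝓡 n) x) (shapeOperator φ ν x) / n

end Hypersurface

/-- The totally umbilical sphere `S^n(u, c) = {p ∈ S^(n+1) : ⟨p, u⟩ = c}`. -/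
def umbilicalSphere (n : ℕ) (u : Ambient n) (c : ℝ) : Set (UnitSphere n) :=
  {p | ⟪(p : Ambient n), u⟫ = c}

/-- `S` is one of the spheres `S^n(u, c)` with `u` a unit vector and `|c| < 1`. -/
def IsUmbilicalSphere {n : ℕ} (S : Set (UnitSphere n)) : Prop :=
  ∃ (u : Ambient n) (c : ℝ), ‖u‖ = 1 ∧ |c| < 1 ∧ S = umbilicalSphere n u c

/-- The standard product `S^k(r) × S^(n-k)(√(1 - r²))` in `S^(n+1) ⊆ ℝ^(k+1) × ℝ^(n-k+1)`: the first
`k + 1` coordinates form a vector of norm `r`, the others one of norm `√(1 - r²)`. -/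
def cliffordProduct (n k : ℕ) (r : ℝ) : Set (UnitSphere n) :=
  {p | (∑ i : Fin (n + 2) with i.val < k + 1, (p : Ambient n) i ^ 2) = r ^ 2 ∧
    (∑ i : Fin (n + 2) with k + 1 ≤ i.val, (p : Ambient n) i ^ 2) = 1 - r ^ 2}

/-- `S` is a Clifford hypersurface: up to a rigid motion `g` of `S^(n+1)` (the restriction of a
linear isometry of `ℝ^(n+2)`), it equals `S^k(r) × S^(n-k)(√(1 - r²))` for some `1 ≤ k ≤ n - 1`
and `0 < r < 1`. -/
def IsCliffordHypersurface {n : ℕ} (S : Set (UnitSphere n)) : Prop :=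
  ∃ (k : ℕ) (r : ℝ) (g : Ambient n ≃ₗᵢ[ℝ] Ambient n),
    1 ≤ k ∧ k + 1 ≤ n ∧ 0 < r ∧ r < 1 ∧
      (Subtype.val '' S : Set (Ambient n)) = g '' (Subtype.val '' cliffordProduct n k r)

end

/-- `F` parametrizes a piece of a hypersurface of the unit sphere of `W`, with unit normal `N`. -/
structure IsHypersurfacePatch {V W : Type*} [NormedAddCommGroup V] [NormedSpace ℝ V]
    [NormedAddCommGroup W] [InnerProductSpace ℝ W] (F N : V → W) (U : Set V) : Prop where
  isOpen : IsOpen U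
  contDiffOn : ContDiffOn ℝ ∞ F U
  contDiffOn_normal : ContDiffOn ℝ ∞ N U
  norm_eq_one : ∀ y ∈ U, ‖F y‖ = 1
  norm_normal : ∀ y ∈ U, ‖N y‖ = 1
  inner_normal : ∀ y ∈ U, ⟪N y, F y⟫ = 0
  inner_normal_fderiv : ∀ y ∈ U, ∀ w, ⟪N y, fderiv ℝ F y w⟫ = 0
  injective_fderiv : ∀ y ∈ U, Function.Injective (fderiv ℝ F y)

theorem ContDiffAt.clm_coprod {V X Y W : Type*} [NormedAddCommGroup V] [NormedSpace ℝ V]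
    [NormedAddCommGroup X] [NormedSpace ℝ X] [NormedAddCommGroup Y] [NormedSpace ℝ Y]
    [NormedAddCommGroup W] [NormedSpace ℝ W] {n : WithTop ℕ∞} {y : V}
    {f : V → X →L[ℝ] W} {g : V → Y →L[ℝ] W} (hf : ContDiffAt ℝ n f y) (hg : ContDiffAt ℝ n g y) :
    ContDiffAt ℝ n (fun z ↦ (f z).coprod (g z)) y := by
  have : (fun z ↦ (f z).coprod (g z)) = fun z ↦ (f z).comp (ContinuousLinearMap.fst ℝ X Y)
      + (g z).comp (ContinuousLinearMap.snd ℝ X Y) := by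
    ext z x <;> simp
  rw [this]
  exact (hf.clm_comp contDiffAt_const).add (hg.clm_comp contDiffAt_const)

namespace IsHypersurfacePatch

variable {V W : Type*} [NormedAddCommGroup V] [NormedSpace ℝ V]
  [NormedAddCommGroup W] [InnerProductSpace ℝ W]

/-- The map `(w, a, b) ↦ dF w + a F + b N`. -/
noncomputable def frame (F N : V → W) (y : V) : V × ℝ × ℝ →L[ℝ] W :=
  (fderiv ℝ F y).coprod
    ((ContinuousLinearMap.toSpanSingleton ℝ (F y)).coprod
      (ContinuousLinearMap.toSpanSingleton ℝ (N y)))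

/-- The left inverse of `dF` which vanishes on `F` and `N`. -/
noncomputable def tangentPart (F N : V → W) (y : V) : W →L[ℝ] V :=
  (ContinuousLinearMap.fst ℝ V (ℝ × ℝ)).comp (frame F N y).inverse

/-- The shape operator in the coordinates of the patch. -/
noncomputable def shape (F N : V → W) (y : V) : V →L[ℝ] V :=
  -((tangentPart F N y).comp (fderiv ℝ N y))

theorem frame_apply (F N : V → W) (y w : V) (a b : ℝ) :
    frame F N y (w, a, b) = fderiv ℝ F y w + a • F y + b • N y := by
  simp [frame, add_assoc]

variable {F N : V → W} {U : Set V} {y : V}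

theorem contDiffAt (h : IsHypersurfacePatch F N U) (hy : y ∈ U) : ContDiffAt ℝ ∞ F y :=
  h.contDiffOn.contDiffAt (h.isOpen.mem_nhds hy)

theorem contDiffAt_normal (h : IsHypersurfacePatch F N U) (hy : y ∈ U) : ContDiffAt ℝ ∞ N y :=
  h.contDiffOn_normal.contDiffAt (h.isOpen.mem_nhds hy)

theorem hasFDerivAt (h : IsHypersurfacePatch F N U) (hy : y ∈ U) :
    HasFDerivAt F (fderiv ℝ F y) y :=
  ((h.contDiffAt hy).differentiableAt (by simp)).hasFDerivAt

theorem hasFDerivAt_normal (h : IsHypersurfacePatch F N U) (hy : y ∈ U) :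
    HasFDerivAt N (fderiv ℝ N y) y :=
  ((h.contDiffAt_normal hy).differentiableAt (by simp)).hasFDerivAt

end IsHypersurfacePatch

/-- Two functions that agree on an open set have the same derivative there. -/
theorem HasFDerivAt.eq_of_eqOn {V Y : Type*} [NormedAddCommGroup V] [NormedSpace ℝ V]
    [NormedAddCommGroup Y] [NormedSpace ℝ Y] {f g : V → Y} {f' g' : V →L[ℝ] Y} {U : Set V} {y : V}
    (hf : HasFDerivAt f f' y) (hg : HasFDerivAt g g' y) (hU : IsOpen U) (hy : y ∈ U)
    (h : ∀ z ∈ U, f z = g z) : f' = g' :=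
  hf.unique (hg.congr_of_eventuallyEq (Filter.eventuallyEq_of_mem (hU.mem_nhds hy) h))

namespace IsHypersurfacePatch

variable {V W : Type*} [NormedAddCommGroup V] [NormedSpace ℝ V]
  [NormedAddCommGroup W] [InnerProductSpace ℝ W]
variable {F N : V → W} {U : Set V} {y : V}

theorem inner_fderiv (h : IsHypersurfacePatch F N U) (hy : y ∈ U) (w : V) :
    ⟪F y, fderiv ℝ F y w⟫ = 0 := by
  have h1 := ((h.hasFDerivAt hy).inner ℝ (h.hasFDerivAt hy)).eq_of_eqOn
    (hasFDerivAt_const (1 : ℝ) y) h.isOpen hy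
    (fun z hz ↦ by simp [h.norm_eq_one z hz])
  have h2 := DFunLike.congr_fun h1 w
  simp [fderivInnerCLM_apply, real_inner_comm] at h2
  linarith

theorem inner_fderiv_normal (h : IsHypersurfacePatch F N U) (hy : y ∈ U) (w : V) :
    ⟪N y, fderiv ℝ N y w⟫ = 0 := by
  have h1 := ((h.hasFDerivAt_normal hy).inner ℝ (h.hasFDerivAt_normal hy)).eq_of_eqOn
    (hasFDerivAt_const (1 : ℝ) y) h.isOpen hy
    (fun z hz ↦ by simp [h.norm_normal z hz])
  have h2 := DFunLike.congr_fun h1 w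
  simp [fderivInnerCLM_apply, real_inner_comm] at h2
  linarith

theorem inner_position_fderiv_normal (h : IsHypersurfacePatch F N U) (hy : y ∈ U) (w : V) :
    ⟪F y, fderiv ℝ N y w⟫ = 0 := by
  have h1 := ((h.hasFDerivAt_normal hy).inner ℝ (h.hasFDerivAt hy)).eq_of_eqOn
    (hasFDerivAt_const (0 : ℝ) y) h.isOpen hy h.inner_normal
  have h2 := DFunLike.congr_fun h1 w
  simp [fderivInnerCLM_apply, h.inner_normal_fderiv y hy] at h2
  rw [real_inner_comm, h2]

theorem contDiffAt_fderiv (h : IsHypersurfacePatch F N U) (hy : y ∈ U) :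
    ContDiffAt ℝ ∞ (fderiv ℝ F) y :=
  (h.contDiffAt hy).fderiv_right (by simp)

theorem contDiffAt_fderiv_normal (h : IsHypersurfacePatch F N U) (hy : y ∈ U) :
    ContDiffAt ℝ ∞ (fderiv ℝ N) y :=
  (h.contDiffAt_normal hy).fderiv_right (by simp)

theorem second_fderiv_symm (h : IsHypersurfacePatch F N U) (hy : y ∈ U) (a b : V) :
    fderiv ℝ (fderiv ℝ F) y a b = fderiv ℝ (fderiv ℝ F) y b a :=
  ((h.contDiffAt hy).isSymmSndFDerivAt (by
    simpa using WithTop.coe_le_coe.2 (le_top : (2 : ℕ∞) ≤ ⊤))) a b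

theorem second_fderiv_normal_symm (h : IsHypersurfacePatch F N U) (hy : y ∈ U) (a b : V) :
    fderiv ℝ (fderiv ℝ N) y a b = fderiv ℝ (fderiv ℝ N) y b a :=
  ((h.contDiffAt_normal hy).isSymmSndFDerivAt (by
    simpa using WithTop.coe_le_coe.2 (le_top : (2 : ℕ∞) ≤ ⊤))) a b

variable [FiniteDimensional ℝ V] [FiniteDimensional ℝ W]

theorem frame_isInvertible (h : IsHypersurfacePatch F N U) (hy : y ∈ U)
    (hd : Module.finrank ℝ W = Module.finrank ℝ V + 2) : (frame F N y).IsInvertible := by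
  have hinj : Function.Injective (frame F N y) := by
    rw [injective_iff_map_eq_zero]
    rintro ⟨w, a, b⟩ h0
    rw [frame_apply] at h0
    have hF : ⟪F y, F y⟫ = 1 := by simp [h.norm_eq_one y hy]
    have hN : ⟪N y, N y⟫ = 1 := by simp [h.norm_normal y hy]
    have hFN : ⟪F y, N y⟫ = 0 := by rw [real_inner_comm, h.inner_normal y hy]
    have ha := congrArg (fun z ↦ ⟪F y, z⟫) h0
    have hb := congrArg (fun z ↦ ⟪N y, z⟫) h0
    simp only [inner_add_right, inner_smul_right, h.inner_fderiv hy, hF, hFN, inner_zero_right,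
      h.inner_normal_fderiv y hy, hN, h.inner_normal y hy] at ha hb
    obtain rfl : a = 0 := by linarith
    obtain rfl : b = 0 := by linarith
    have := h.injective_fderiv y hy (a₁ := w) (a₂ := 0) (by simpa using h0)
    simp [this]
  have hfr : Module.finrank ℝ (V × ℝ × ℝ) = Module.finrank ℝ W := by
    simp [hd, Module.finrank_prod]
  refine ⟨(LinearEquiv.ofInjectiveOfFinrankEq (frame F N y).toLinearMap hinj
    hfr).toContinuousLinearEquiv, ?_⟩
  ext <;> simp [LinearEquiv.ofInjectiveOfFinrankEq]

theorem inverse_frame_apply (h : IsHypersurfacePatch F N U) (hy : y ∈ U)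
    (hd : Module.finrank ℝ W = Module.finrank ℝ V + 2) (w : V) (a b : ℝ) :
    (frame F N y).inverse (fderiv ℝ F y w + a • F y + b • N y) = (w, a, b) := by
  rw [← frame_apply, ← ContinuousLinearMap.comp_apply,
    (h.frame_isInvertible hy hd).inverse_comp_self]
  rfl

theorem tangentPart_apply (h : IsHypersurfacePatch F N U) (hy : y ∈ U)
    (hd : Module.finrank ℝ W = Module.finrank ℝ V + 2) (w : V) (a b : ℝ) :
    tangentPart F N y (fderiv ℝ F y w + a • F y + b • N y) = w := by
  simp [tangentPart, h.inverse_frame_apply hy hd]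

theorem tangentPart_fderiv (h : IsHypersurfacePatch F N U) (hy : y ∈ U)
    (hd : Module.finrank ℝ W = Module.finrank ℝ V + 2) (w : V) :
    tangentPart F N y (fderiv ℝ F y w) = w := by
  simpa using h.tangentPart_apply hy hd w 0 0

theorem tangentPart_position (h : IsHypersurfacePatch F N U) (hy : y ∈ U)
    (hd : Module.finrank ℝ W = Module.finrank ℝ V + 2) : tangentPart F N y (F y) = 0 := by
  simpa using h.tangentPart_apply hy hd 0 1 0

theorem tangentPart_normal (h : IsHypersurfacePatch F N U) (hy : y ∈ U)
    (hd : Module.finrank ℝ W = Module.finrank ℝ V + 2) : tangentPart F N y (N y) = 0 := by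
  simpa using h.tangentPart_apply hy hd 0 0 1

theorem fderiv_tangentPart (h : IsHypersurfacePatch F N U) (hy : y ∈ U)
    (hd : Module.finrank ℝ W = Module.finrank ℝ V + 2) (w : W) :
    fderiv ℝ F y (tangentPart F N y w) = w - ⟪F y, w⟫ • F y - ⟪N y, w⟫ • N y := by
  obtain ⟨⟨x, a, b⟩, rfl⟩ := (h.frame_isInvertible hy hd).surjective w
  have hF : ⟪F y, F y⟫ = 1 := by simp [h.norm_eq_one y hy]
  have hN : ⟪N y, N y⟫ = 1 := by simp [h.norm_normal y hy]
  have hFN : ⟪F y, N y⟫ = 0 := by rw [real_inner_comm, h.inner_normal y hy]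
  rw [frame_apply, h.tangentPart_apply hy hd]
  simp only [inner_add_right, inner_smul_right, h.inner_fderiv hy, hF, hFN,
      h.inner_normal_fderiv y hy, hN, h.inner_normal y hy]
  simp only [mul_one, mul_zero, add_zero, zero_add]
  abel

theorem fderiv_shape (h : IsHypersurfacePatch F N U) (hy : y ∈ U)
    (hd : Module.finrank ℝ W = Module.finrank ℝ V + 2) (w : V) :
    fderiv ℝ F y (shape F N y w) = -fderiv ℝ N y w := by
  simp [shape, h.fderiv_tangentPart hy hd, h.inner_position_fderiv_normal hy,
    h.inner_fderiv_normal hy]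

theorem contDiffAt_tangentPart (h : IsHypersurfacePatch F N U) (hy : y ∈ U)
    (hd : Module.finrank ℝ W = Module.finrank ℝ V + 2) : ContDiffAt ℝ ∞ (tangentPart F N) y := by
  have hs (f : V → W) (hf : ContDiffAt ℝ ∞ f y) :
      ContDiffAt ℝ ∞ (fun z ↦ ContinuousLinearMap.toSpanSingleton ℝ (f z)) y :=
    (ContinuousLinearMap.toSpanSingletonCLE (𝕜 := ℝ) (E := W)).contDiff.contDiffAt.comp y hf
  have hframe : ContDiffAt ℝ ∞ (frame F N) y :=
    (h.contDiffAt_fderiv hy).clm_coprod ((hs _ (h.contDiffAt hy)).clm_coprod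
      (hs _ (h.contDiffAt_normal hy)))
  have hinv : ContDiffAt ℝ ∞ (fun z ↦ (frame F N z).inverse) y :=
    ((h.frame_isInvertible hy hd).contDiffAt_map_inverse).comp y hframe
  exact contDiffAt_const.clm_comp hinv

theorem contDiffAt_shape (h : IsHypersurfacePatch F N U) (hy : y ∈ U)
    (hd : Module.finrank ℝ W = Module.finrank ℝ V + 2) : ContDiffAt ℝ ∞ (shape F N) y :=
  ((h.contDiffAt_tangentPart hy hd).clm_comp (h.contDiffAt_fderiv_normal hy)).neg

theorem inner_fderiv_shape (h : IsHypersurfacePatch F N U) (hy : y ∈ U)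
    (hd : Module.finrank ℝ W = Module.finrank ℝ V + 2) (a b : V) :
    ⟪fderiv ℝ F y (shape F N y a), fderiv ℝ F y b⟫ =
      ⟪fderiv ℝ F y a, fderiv ℝ F y (shape F N y b)⟫ := by
  have key (a b : V) : ⟪fderiv ℝ N y a, fderiv ℝ F y b⟫ = -⟪N y, fderiv ℝ (fderiv ℝ F) y a b⟫ := by
    have hF' := ((h.contDiffAt_fderiv hy).differentiableAt (by simp)).hasFDerivAt
    have h1 := ((h.hasFDerivAt_normal hy).inner ℝ
      (hF'.clm_apply (hasFDerivAt_const b y))).eq_of_eqOn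
      (hasFDerivAt_const (0 : ℝ) y) h.isOpen hy (fun z hz ↦ h.inner_normal_fderiv z hz b)
    have h2 := DFunLike.congr_fun h1 a
    simp [fderivInnerCLM_apply] at h2
    linarith
  rw [h.fderiv_shape hy hd, h.fderiv_shape hy hd, inner_neg_left, inner_neg_right, key,
    real_inner_comm (fderiv ℝ N y b), key, h.second_fderiv_symm hy]

end IsHypersurfacePatch

/-- The trace of continuous linear endomorphisms, as a continuous linear form. -/
noncomputable def ContinuousLinearMap.traceCLM (V : Type*) [NormedAddCommGroup V] [NormedSpace ℝ V]
    [FiniteDimensional ℝ V] : (V →L[ℝ] V) →L[ℝ] ℝ :=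
  LinearMap.toContinuousLinearMap (LinearMap.trace ℝ V ∘ₗ ContinuousLinearMap.coeLM ℝ)

theorem ContinuousLinearMap.traceCLM_apply {V : Type*} [NormedAddCommGroup V] [NormedSpace ℝ V]
    [FiniteDimensional ℝ V] (a : V →L[ℝ] V) : traceCLM V a = LinearMap.trace ℝ V a := rfl

theorem ContinuousLinearMap.traceCLM_mul_comm {V : Type*} [NormedAddCommGroup V] [NormedSpace ℝ V]
    [FiniteDimensional ℝ V] (a b : V →L[ℝ] V) : traceCLM V (a * b) = traceCLM V (b * a) :=
  LinearMap.trace_mul_comm ℝ (a : V →ₗ[ℝ] V) b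

/-- A linear map that is symmetric for the inner product induced by an injective map, and whose
square has trace zero, vanishes. -/
theorem LinearMap.eq_zero_of_trace_sq_eq_zero {V W : Type*} [AddCommGroup V] [Module ℝ V]
    [FiniteDimensional ℝ V] [NormedAddCommGroup W] [InnerProductSpace ℝ W] (D : V →ₗ[ℝ] W)
    (hD : Function.Injective D) (p : V →ₗ[ℝ] V) (hp : ∀ a b, ⟪D (p a), D b⟫ = ⟪D a, D (p b)⟫)
    (ht : LinearMap.trace ℝ V (p ∘ₗ p) = 0) : p = 0 := by
  let e : V ≃ₗ[ℝ] D.range := LinearEquiv.ofInjective D hD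
  have he (a b : V) : ⟪e a, e b⟫ = ⟪D a, D b⟫ := rfl
  let b := stdOrthonormalBasis ℝ D.range
  have h1 : LinearMap.trace ℝ D.range (e.conj (p ∘ₗ p)) = 0 := by rw [LinearMap.trace_conj', ht]
  rw [LinearMap.trace_eq_sum_inner _ b] at h1
  have h2 (i) : ⟪b i, e.conj (p ∘ₗ p) (b i)⟫ = ‖e (p (e.symm (b i)))‖ ^ 2 := by
    obtain ⟨a, ha⟩ := e.surjective (b i)
    rw [← ha, ← real_inner_self_eq_norm_sq]
    simp only [LinearEquiv.conj_apply, LinearMap.comp_apply, LinearEquiv.coe_coe,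
      LinearEquiv.symm_apply_apply, he]
    exact (hp _ _).symm
  simp only [h2] at h1
  rw [Finset.sum_eq_zero_iff_of_nonneg (fun _ _ ↦ by positivity)] at h1
  have h3 : p ∘ₗ e.symm.toLinearMap = 0 := by
    apply b.toBasis.ext
    intro i
    have := h1 i (Finset.mem_univ _)
    simpa using this
  ext x
  simpa using DFunLike.congr_fun h3 (e x)

namespace IsHypersurfacePatch

variable {V W : Type*} [NormedAddCommGroup V] [NormedSpace ℝ V]
  [NormedAddCommGroup W] [InnerProductSpace ℝ W]
  [FiniteDimensional ℝ V] [FiniteDimensional ℝ W]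
variable {F N : V → W} {U : Set V} {y : V} {v : W} {μ : ℝ}

/-- The tangential part of the constant vector field `v` is a principal direction where
`⟨N, v⟩ = μ ⟨F, v⟩`. -/
theorem shape_tangentPart (h : IsHypersurfacePatch F N U)
    (hd : Module.finrank ℝ W = Module.finrank ℝ V + 2) (hμ : ∀ z ∈ U, ⟪N z, v⟫ = μ * ⟪F z, v⟫)
    (hy : y ∈ U) : shape F N y (tangentPart F N y v) = -μ • tangentPart F N y v := by
  have h1 := ((h.hasFDerivAt_normal hy).inner ℝ (hasFDerivAt_const v y)).eq_of_eqOn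
    (((h.hasFDerivAt hy).inner ℝ (hasFDerivAt_const v y)).const_mul μ) h.isOpen hy hμ
  have h2 (x : V) : ⟪fderiv ℝ N y x, v⟫ = μ * ⟪fderiv ℝ F y x, v⟫ := by
    simpa [fderivInnerCLM_apply] using DFunLike.congr_fun h1 x
  have hv : v = fderiv ℝ F y (tangentPart F N y v) + ⟪F y, v⟫ • F y + ⟪N y, v⟫ • N y := by
    rw [h.fderiv_tangentPart hy hd]; abel
  set T := tangentPart F N y v with hT
  have h3 (x : V) : ⟪fderiv ℝ F y x, v⟫ = ⟪fderiv ℝ F y x, fderiv ℝ F y T⟫ := by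
    conv_lhs => rw [hv]
    simp only [inner_add_right, inner_smul_right]
    rw [real_inner_comm (F y), real_inner_comm (N y), h.inner_fderiv hy,
      h.inner_normal_fderiv y hy]
    ring
  have h4 (x : V) : ⟪fderiv ℝ F y x, fderiv ℝ F y (shape F N y T + μ • T)⟫ = 0 := by
    have h5 := h2 (-x)
    have h6 : ⟪fderiv ℝ N y (-x), v⟫ = ⟪fderiv ℝ F y (shape F N y x), v⟫ := by
      rw [h.fderiv_shape hy hd, map_neg]
    rw [h6, h3, h3, h.inner_fderiv_shape hy hd] at h5
    simp only [map_neg, inner_neg_left] at h5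
    simp only [map_add, map_smul, inner_add_right, inner_smul_right]
    linarith
  have h5 := inner_self_eq_zero.1 (h4 _)
  have h6 := h.injective_fderiv y hy (h5.trans (map_zero _).symm)
  rw [neg_smul]
  exact eq_neg_of_add_eq_zero_left h6

/-- The Codazzi equation in coordinates. -/
theorem codazzi (h : IsHypersurfacePatch F N U)
    (hd : Module.finrank ℝ W = Module.finrank ℝ V + 2) (hy : y ∈ U) (a b : V) :
    tangentPart F N y (fderiv ℝ (fderiv ℝ F) y a (shape F N y b)) + fderiv ℝ (shape F N) y a b =
      tangentPart F N y (fderiv ℝ (fderiv ℝ F) y b (shape F N y a)) +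
        fderiv ℝ (shape F N) y b a := by
  have hF' := ((h.contDiffAt_fderiv hy).differentiableAt (by simp)).hasFDerivAt
  have hN' := ((h.contDiffAt_fderiv_normal hy).differentiableAt (by simp)).hasFDerivAt
  have hS' := ((h.contDiffAt_shape hy hd).differentiableAt (by simp)).hasFDerivAt
  have key (a b : V) : fderiv ℝ (fderiv ℝ F) y a (shape F N y b) +
      fderiv ℝ F y (fderiv ℝ (shape F N) y a b) = -fderiv ℝ (fderiv ℝ N) y a b := by
    have h1 := (hF'.clm_apply (hS'.clm_apply (hasFDerivAt_const b y))).eq_of_eqOn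
      ((hN'.clm_apply (hasFDerivAt_const b y)).neg) h.isOpen hy (fun z hz ↦ h.fderiv_shape hz hd b)
    have h2 := DFunLike.congr_fun h1 a
    simp at h2
    rw [← h2, add_comm]
  have h3 := congrArg (tangentPart F N y) ((key a b).trans
    ((congrArg Neg.neg (h.second_fderiv_normal_symm hy a b)).trans (key b a).symm))
  simpa [h.tangentPart_fderiv hy hd] using h3

theorem fderiv_tangentPart_apply (h : IsHypersurfacePatch F N U)
    (hd : Module.finrank ℝ W = Module.finrank ℝ V + 2) (hy : y ∈ U) (a : V) :
    fderiv ℝ (tangentPart F N) y a v =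
      -tangentPart F N y (fderiv ℝ (fderiv ℝ F) y a (tangentPart F N y v)) - ⟪F y, v⟫ • a +
        ⟪N y, v⟫ • shape F N y a := by
  have hF' := ((h.contDiffAt_fderiv hy).differentiableAt (by simp)).hasFDerivAt
  have hT' := ((h.contDiffAt_tangentPart hy hd).differentiableAt (by simp)).hasFDerivAt
  have hF := h.hasFDerivAt hy
  have hN := h.hasFDerivAt_normal hy
  have h1 := (hF'.clm_apply (hT'.clm_apply (hasFDerivAt_const v y))).eq_of_eqOn
    (((hasFDerivAt_const v y).sub ((hF.inner ℝ (hasFDerivAt_const v y)).smul hF)).sub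
      ((hN.inner ℝ (hasFDerivAt_const v y)).smul hN)) h.isOpen hy
    (fun z hz ↦ h.fderiv_tangentPart hz hd v)
  have h2 := congrArg (tangentPart F N y) (DFunLike.congr_fun h1 a)
  simp [h.tangentPart_fderiv hy hd, h.tangentPart_position hy hd, h.tangentPart_normal hy hd] at h2
  have h3 : shape F N y a = -tangentPart F N y (fderiv ℝ N y a) := rfl
  rw [h3, eq_sub_of_add_eq h2]
  module

/-- Up to a commutator, the derivative of the shape operator along the tangential part of `v` is
`⟨F, v⟩ (S + μ) (1 - μ S)`. -/
theorem exists_fderiv_shape_tangentPart (h : IsHypersurfacePatch F N U)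
    (hd : Module.finrank ℝ W = Module.finrank ℝ V + 2) (hμ : ∀ z ∈ U, ⟪N z, v⟫ = μ * ⟪F z, v⟫)
    (hy : y ∈ U) : ∃ Γ : V →L[ℝ] V, fderiv ℝ (shape F N) y (tangentPart F N y v) =
      shape F N y * Γ - Γ * shape F N y +
        ⟪F y, v⟫ • ((shape F N y + μ • 1) * (1 - μ • shape F N y)) := by
  have hT' := ((h.contDiffAt_tangentPart hy hd).differentiableAt (by simp)).hasFDerivAt
  have hS' := ((h.contDiffAt_shape hy hd).differentiableAt (by simp)).hasFDerivAt
  have hTv := hT'.clm_apply (hasFDerivAt_const v y)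
  refine ⟨(tangentPart F N y).comp (fderiv ℝ (fderiv ℝ F) y (tangentPart F N y v)), ?_⟩
  ext b
  have h1 := (hS'.clm_apply hTv).eq_of_eqOn (hTv.const_smul (-μ)) h.isOpen hy
    (fun z hz ↦ h.shape_tangentPart hd hμ hz)
  have h2 := DFunLike.congr_fun h1 b
  simp only [ContinuousLinearMap.comp_zero, zero_add, add_apply,
    ContinuousLinearMap.comp_apply, ContinuousLinearMap.flip_apply,
    smul_apply, h.fderiv_tangentPart_apply hd hy, hμ y hy] at h2
  have h3 := h.codazzi hd hy (tangentPart F N y v) b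
  rw [h.shape_tangentPart hd hμ hy] at h3
  simp only [map_add, map_sub, map_neg, map_smul] at h2 h3
  rw [h.second_fderiv_symm hy b] at h2 h3
  rw [eq_sub_of_add_eq' h3, eq_sub_of_add_eq' h2]
  simp only [add_apply, sub_apply,
    mul_apply_eq_comp, smul_apply, one_apply_eq_self,
    ContinuousLinearMap.comp_apply, map_sub, map_smul]
  module

end IsHypersurfacePatch

theorem hasFDerivAt_traceCLM_mul {V X : Type*} [NormedAddCommGroup V] [NormedSpace ℝ V]
    [FiniteDimensional ℝ V] [NormedAddCommGroup X] [NormedSpace ℝ X] {A B : X → V →L[ℝ] V}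
    {A' B' : X →L[ℝ] V →L[ℝ] V} {x : X} (hA : HasFDerivAt A A' x) (hB : HasFDerivAt B B' x) :
    ∃ L : X →L[ℝ] ℝ,
      HasFDerivAt (fun z ↦ ContinuousLinearMap.traceCLM V (A z * B z)) L x ∧
        ∀ a, L a = ContinuousLinearMap.traceCLM V (A x * B' a) +
          ContinuousLinearMap.traceCLM V (A' a * B x) := by
  refine ⟨_, (ContinuousLinearMap.traceCLM V).hasFDerivAt.comp x (hA.clm_comp hB), fun a ↦ ?_⟩
  rw [← map_add]
  rfl

namespace IsHypersurfacePatch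

open ContinuousLinearMap (traceCLM traceCLM_mul_comm traceCLM_apply)

variable {V W : Type*} [NormedAddCommGroup V] [NormedSpace ℝ V]
  [NormedAddCommGroup W] [InnerProductSpace ℝ W]
  [FiniteDimensional ℝ V] [FiniteDimensional ℝ W]
variable {F N : V → W} {U : Set V} {y : V} {v : W} {μ : ℝ}

/-- The height function `⟨F, v⟩` does not vanish on an open set when `⟨N, v⟩ = μ ⟨F, v⟩`. -/
theorem eq_zero_of_inner_mul_eq_zero (h : IsHypersurfacePatch F N U)
    (hd : Module.finrank ℝ W = Module.finrank ℝ V + 2) (hv : v ≠ 0)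
    (hμ : ∀ z ∈ U, ⟪N z, v⟫ = μ * ⟪F z, v⟫) {u : V → ℝ} (hu : ContinuousOn u U)
    (huz : ∀ z ∈ U, ⟪F z, v⟫ * u z = 0) (hy : y ∈ U) : u y = 0 := by
  by_contra hne
  have h1 : ∀ᶠ z in nhds y, ⟪F z, v⟫ = 0 := by
    filter_upwards [(hu.continuousAt (h.isOpen.mem_nhds hy)).eventually_ne hne,
      h.isOpen.mem_nhds hy] with z hz hzU
    exact (mul_eq_zero.1 (huz z hzU)).resolve_right hz
  have h2 := ((h.hasFDerivAt hy).inner ℝ (hasFDerivAt_const v y)).unique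
    ((hasFDerivAt_const (0 : ℝ) y).congr_of_eventuallyEq h1)
  have h3 (x : V) : ⟪fderiv ℝ F y x, v⟫ = 0 := by
    simpa [fderivInnerCLM_apply] using DFunLike.congr_fun h2 x
  have h4 := h3 (tangentPart F N y v)
  rw [h.fderiv_tangentPart hy hd, hμ y hy, h1.self_of_nhds] at h4
  simp at h4
  exact hv h4

theorem trace_mul_fderiv_shape (h : IsHypersurfacePatch F N U)
    (hd : Module.finrank ℝ W = Module.finrank ℝ V + 2) (hμ : ∀ z ∈ U, ⟪N z, v⟫ = μ * ⟪F z, v⟫)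
    (hy : y ∈ U) {Q : V →L[ℝ] V} (hQ : Commute Q (shape F N y)) :
    traceCLM V (Q * fderiv ℝ (shape F N) y (tangentPart F N y v)) =
      ⟪F y, v⟫ * traceCLM V (Q * ((shape F N y + μ • 1) * (1 - μ • shape F N y))) := by
  obtain ⟨Γ, hΓ⟩ := h.exists_fderiv_shape_tangentPart hd hμ hy
  rw [hΓ, mul_add, mul_sub, map_add, map_sub, mul_smul_comm, map_smul, smul_eq_mul]
  have : traceCLM V (Q * (Γ * shape F N y)) = traceCLM V (Q * (shape F N y * Γ)) := by
    rw [← mul_assoc, traceCLM_mul_comm, ← mul_assoc, ← mul_assoc, hQ.eq]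
  rw [this]
  ring

/-- If `⟨N, v⟩ = μ ⟨F, v⟩` with `v ≠ 0`, `μ ≠ 0`, and the mean curvature is constant, then the only
possible principal curvatures are `-μ` and `1 / μ`. -/
theorem shape_mul_eq_zero (h : IsHypersurfacePatch F N U)
    (hd : Module.finrank ℝ W = Module.finrank ℝ V + 2) (hv : v ≠ 0) (hμ0 : μ ≠ 0)
    (hμ : ∀ z ∈ U, ⟪N z, v⟫ = μ * ⟪F z, v⟫) {C : ℝ}
    (hC : ∀ z ∈ U, traceCLM V (shape F N z) = C) (hy : y ∈ U) :
    (shape F N y + μ • 1) * (1 - μ • shape F N y) = 0 := by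
  set S := shape F N with hS
  set p : V → V →L[ℝ] V := fun z ↦ (S z + μ • 1) * (1 - μ • S z) with hp
  have hpS (z : V) : p z = -μ • (S z * S z) + (1 - μ ^ 2) • S z + μ • 1 := by
    simp only [hp, add_mul, mul_sub, mul_smul_comm, smul_mul_assoc, mul_one, one_mul]
    module
  have hSd {z : V} (hz : z ∈ U) : HasFDerivAt S (fderiv ℝ S z) z :=
    ((h.contDiffAt_shape hz hd).differentiableAt (by simp)).hasFDerivAt
  have hSc : ContinuousOn S U := fun z hz ↦ (hSd hz).continuousAt.continuousWithinAt
  have hpc : ContinuousOn p U := by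
    simp only [hp]; fun_prop
  have step {Q : V → V →L[ℝ] V} (hQc : ContinuousOn Q U) (hQ : ∀ z, Commute (Q z) (S z))
      (h0 : ∀ z ∈ U, traceCLM V (Q z * fderiv ℝ S z (tangentPart F N z v)) = 0) :
      ∀ z ∈ U, traceCLM V (Q z * p z) = 0 := by
    intro z hz
    refine h.eq_zero_of_inner_mul_eq_zero (u := fun z ↦ traceCLM V (Q z * p z)) hd hv hμ
      (by fun_prop) (fun x hx ↦ ?_) hz
    rw [← h0 x hx]
    exact (h.trace_mul_fderiv_shape hd hμ hx (hQ x)).symm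
  have d1 : ∀ z ∈ U, ∀ a, traceCLM V (fderiv ℝ S z a) = 0 := by
    intro z hz a
    have h1 := ((traceCLM V).hasFDerivAt.comp z (hSd hz)).eq_of_eqOn (hasFDerivAt_const C z)
      h.isOpen hz hC
    simpa using DFunLike.congr_fun h1 a
  have s1 : ∀ z ∈ U, traceCLM V (p z) = 0 := by
    simpa using step (Q := fun _ ↦ 1) continuousOn_const (fun _ ↦ Commute.one_left _)
      (fun z hz ↦ by simpa using d1 z hz _)
  have d2 : ∀ z ∈ U, ∀ a, traceCLM V (S z * fderiv ℝ S z a) = 0 := by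
    intro z hz a
    obtain ⟨L, hL, hLa⟩ := hasFDerivAt_traceCLM_mul (hSd hz) (hSd hz)
    have hL1 := (traceCLM V).hasFDerivAt.comp z (hSd hz)
    have h1 := ((hL.const_mul (-μ)).add (hL1.const_mul (1 - μ ^ 2))).eq_of_eqOn
      (hasFDerivAt_const (-(traceCLM V (μ • 1))) z) h.isOpen hz (fun x hx ↦ by
        have := s1 x hx
        rw [hpS, map_add] at this
        simpa using eq_neg_of_add_eq_zero_left this)
    have h2 := DFunLike.congr_fun h1 a
    simp [d1 z hz, hμ0, hLa] at h2
    rw [traceCLM_mul_comm (fderiv ℝ S z a)] at h2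
    linarith
  have s2 : ∀ z ∈ U, traceCLM V (S z * p z) = 0 :=
    step hSc (fun _ ↦ Commute.refl _) (fun z hz ↦ d2 z hz _)
  have d3 : ∀ z ∈ U, ∀ a, traceCLM V (S z * S z * fderiv ℝ S z a) = 0 := by
    intro z hz a
    obtain ⟨L2, hL2, hL2a⟩ := hasFDerivAt_traceCLM_mul (hSd hz) (hSd hz)
    obtain ⟨L3, hL3, hL3a⟩ := hasFDerivAt_traceCLM_mul ((hSd hz).clm_comp (hSd hz)) (hSd hz)
    have hL1 := (traceCLM V).hasFDerivAt.comp z (hSd hz)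
    have h1 := ((hL3.const_mul (-μ)).add ((hL2.const_mul (1 - μ ^ 2)).add
      (hL1.const_mul μ))).eq_of_eqOn (hasFDerivAt_const (0 : ℝ) z) h.isOpen hz (fun x hx ↦ by
        rw [← s2 x hx, hpS, mul_add, mul_add, map_add, map_add, mul_smul_comm, mul_smul_comm,
          mul_smul_comm, mul_one, map_smul, map_smul, map_smul, ← mul_assoc]
        simp only [smul_eq_mul, add_assoc]
        rfl)
    have h2 := DFunLike.congr_fun h1 a
    have e1 : traceCLM V (fderiv ℝ S z a * S z) = 0 := by rw [traceCLM_mul_comm, d2 z hz]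
    have e2 : traceCLM V ((S z).comp (fderiv ℝ S z a) * S z) =
        traceCLM V (S z * S z * fderiv ℝ S z a) := by
      rw [traceCLM_mul_comm, mul_assoc]; rfl
    have e3 : traceCLM V ((fderiv ℝ S z a).comp (S z) * S z) =
        traceCLM V (S z * S z * fderiv ℝ S z a) := by
      rw [traceCLM_mul_comm (S z * S z)]; rfl
    have e4 : traceCLM V ((S z).comp (S z) * fderiv ℝ S z a) =
        traceCLM V (S z * S z * fderiv ℝ S z a) := rfl
    simp [d1 z hz, hL2a, hL3a, d2 z hz, e1, e4, hμ0] at h2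
    rw [add_mul, map_add, e2, e3] at h2
    linarith
  have s3 : ∀ z ∈ U, traceCLM V (S z * S z * p z) = 0 :=
    step (Q := fun z ↦ S z * S z) (by fun_prop) (fun z ↦ (Commute.refl (S z)).mul_left (Commute.refl _))
      (fun z hz ↦ d3 z hz _)
  have hpp : traceCLM V (p y * p y) = 0 := by
    have := congrArg (fun q ↦ traceCLM V (q * p y)) (hpS y)
    refine this.trans ?_
    simp only [add_mul, smul_mul_assoc, one_mul, map_add, map_smul, s1 y hy, s2 y hy, s3 y hy]
    simp
  have hpsymm (a b : V) : ⟪fderiv ℝ F y (p y a), fderiv ℝ F y b⟫ =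
      ⟪fderiv ℝ F y a, fderiv ℝ F y (p y b)⟫ := by
    simp only [hpS, add_apply, smul_apply, mul_apply_eq_comp, one_apply_eq_self, map_add, map_smul,
      inner_add_left, inner_add_right, inner_smul_left, inner_smul_right, hS,
      h.inner_fderiv_shape hy hd]
    simp
  have := LinearMap.eq_zero_of_trace_sq_eq_zero (fderiv ℝ F y).toLinearMap
    (h.injective_fderiv y hy) (p y).toLinearMap hpsymm hpp
  exact ContinuousLinearMap.coe_injective this

end IsHypersurfacePatch

theorem eq_zero_of_inner_eq_zero_of_eq_add {W : Type*} [NormedAddCommGroup W]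
    [InnerProductSpace ℝ W] {w p r : W} (h : w = p + r) (hw : ⟪p, w⟫ = 0) (hr : ⟪p, r⟫ = 0) :
    p = 0 := by
  rw [h, inner_add_right, hr, add_zero] at hw
  exact inner_self_eq_zero.1 hw

namespace IsHypersurfacePatch

variable {V W : Type*} [NormedAddCommGroup V] [NormedSpace ℝ V]
  [NormedAddCommGroup W] [InnerProductSpace ℝ W]

/-- The focal map of the principal curvature `-μ`. -/
def focal (F N : V → W) (μ : ℝ) (y : V) : W := μ • F y - N y

/-- The vector field `F + μ N`, orthogonal to `focal F N μ`. -/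
def cofocal (F N : V → W) (μ : ℝ) (y : V) : W := F y + μ • N y

/-- The orthogonal projection onto the span of the focal map and its derivatives, when `-μ` and
`1 / μ` are the only principal curvatures. -/
noncomputable def focalProj (F N : V → W) (μ : ℝ) (y : V) : W →L[ℝ] W :=
  (1 + μ ^ 2)⁻¹ • ((innerSL ℝ (focal F N μ y)).smulRight (focal F N μ y) +
    μ • (fderiv ℝ (focal F N μ) y).comp (tangentPart F N y))

variable {F N : V → W} {U : Set V} {y : V} {μ : ℝ}

theorem focalProj_apply (w : W) : focalProj F N μ y w =
    (1 + μ ^ 2)⁻¹ • (⟪focal F N μ y, w⟫ • focal F N μ y +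
      μ • fderiv ℝ (focal F N μ) y (tangentPart F N y w)) := by
  simp [focalProj]

theorem contDiffAt_focal (h : IsHypersurfacePatch F N U) (hy : y ∈ U) :
    ContDiffAt ℝ ∞ (focal F N μ) y :=
  ((h.contDiffAt hy).const_smul μ).sub (h.contDiffAt_normal hy)

theorem contDiffAt_cofocal (h : IsHypersurfacePatch F N U) (hy : y ∈ U) :
    ContDiffAt ℝ ∞ (cofocal F N μ) y :=
  (h.contDiffAt hy).add ((h.contDiffAt_normal hy).const_smul μ)

theorem hasFDerivAt_focal (h : IsHypersurfacePatch F N U) (hy : y ∈ U) :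
    HasFDerivAt (focal F N μ) (fderiv ℝ (focal F N μ) y) y :=
  ((h.contDiffAt_focal hy).differentiableAt (by simp)).hasFDerivAt

theorem hasFDerivAt_cofocal (h : IsHypersurfacePatch F N U) (hy : y ∈ U) :
    HasFDerivAt (cofocal F N μ) (fderiv ℝ (cofocal F N μ) y) y :=
  ((h.contDiffAt_cofocal hy).differentiableAt (by simp)).hasFDerivAt

theorem hasFDerivAt_fderiv_focal (h : IsHypersurfacePatch F N U) (hy : y ∈ U) :
    HasFDerivAt (fderiv ℝ (focal F N μ)) (fderiv ℝ (fderiv ℝ (focal F N μ)) y) y :=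
  (((h.contDiffAt_focal hy).fderiv_right (m := ∞) (by simp)).differentiableAt
    (by simp)).hasFDerivAt

theorem hasFDerivAt_fderiv_cofocal (h : IsHypersurfacePatch F N U) (hy : y ∈ U) :
    HasFDerivAt (fderiv ℝ (cofocal F N μ)) (fderiv ℝ (fderiv ℝ (cofocal F N μ)) y) y :=
  (((h.contDiffAt_cofocal hy).fderiv_right (m := ∞) (by simp)).differentiableAt
    (by simp)).hasFDerivAt

theorem second_fderiv_focal_symm (h : IsHypersurfacePatch F N U) (hy : y ∈ U) (a b : V) :
    fderiv ℝ (fderiv ℝ (focal F N μ)) y a b = fderiv ℝ (fderiv ℝ (focal F N μ)) y b a :=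
  ((h.contDiffAt_focal hy).isSymmSndFDerivAt (by
    simpa using WithTop.coe_le_coe.2 (le_top : (2 : ℕ∞) ≤ ⊤))) a b

theorem second_fderiv_cofocal_symm (h : IsHypersurfacePatch F N U) (hy : y ∈ U) (a b : V) :
    fderiv ℝ (fderiv ℝ (cofocal F N μ)) y a b = fderiv ℝ (fderiv ℝ (cofocal F N μ)) y b a :=
  ((h.contDiffAt_cofocal hy).isSymmSndFDerivAt (by
    simpa using WithTop.coe_le_coe.2 (le_top : (2 : ℕ∞) ≤ ⊤))) a b

theorem inner_focal_cofocal (h : IsHypersurfacePatch F N U) (hy : y ∈ U) :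
    ⟪focal F N μ y, cofocal F N μ y⟫ = 0 := by
  have hFN : ⟪F y, N y⟫ = 0 := by rw [real_inner_comm, h.inner_normal y hy]
  simp [focal, cofocal, inner_sub_left, inner_add_right, inner_smul_left, inner_smul_right,
    h.norm_eq_one y hy, h.norm_normal y hy, hFN, h.inner_normal y hy]

theorem inner_focal_self (h : IsHypersurfacePatch F N U) (hy : y ∈ U) :
    ⟪focal F N μ y, focal F N μ y⟫ = 1 + μ ^ 2 := by
  have hFN : ⟪F y, N y⟫ = 0 := by rw [real_inner_comm, h.inner_normal y hy]
  simp only [focal, inner_sub_left, inner_sub_right, inner_smul_left, inner_smul_right,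
    real_inner_self_eq_norm_sq, h.norm_eq_one y hy, h.norm_normal y hy, hFN, h.inner_normal y hy]
  simp
  ring

theorem inner_focal_fderiv (h : IsHypersurfacePatch F N U) (hy : y ∈ U) (a : V) :
    ⟪focal F N μ y, fderiv ℝ F y a⟫ = 0 := by
  simp [focal, inner_sub_left, inner_smul_left, h.inner_fderiv hy, h.inner_normal_fderiv y hy]

theorem inner_cofocal_fderiv (h : IsHypersurfacePatch F N U) (hy : y ∈ U) (a : V) :
    ⟪cofocal F N μ y, fderiv ℝ F y a⟫ = 0 := by
  simp [cofocal, inner_add_left, inner_smul_left, h.inner_fderiv hy, h.inner_normal_fderiv y hy]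

variable [FiniteDimensional ℝ V] [FiniteDimensional ℝ W]

theorem fderiv_focal_apply (h : IsHypersurfacePatch F N U)
    (hd : Module.finrank ℝ W = Module.finrank ℝ V + 2) (hy : y ∈ U) (a : V) :
    fderiv ℝ (focal F N μ) y a = fderiv ℝ F y (shape F N y a + μ • a) := by
  have : HasFDerivAt (focal F N μ) (μ • fderiv ℝ F y - fderiv ℝ N y) y :=
    ((h.hasFDerivAt hy).const_smul μ).sub (h.hasFDerivAt_normal hy)
  rw [this.fderiv, map_add, h.fderiv_shape hy hd]
  simp
  abel

theorem fderiv_cofocal_apply (h : IsHypersurfacePatch F N U)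
    (hd : Module.finrank ℝ W = Module.finrank ℝ V + 2) (hy : y ∈ U) (a : V) :
    fderiv ℝ (cofocal F N μ) y a = fderiv ℝ F y (a - μ • shape F N y a) := by
  have : HasFDerivAt (cofocal F N μ) (fderiv ℝ F y + μ • fderiv ℝ N y) y :=
    (h.hasFDerivAt hy).add ((h.hasFDerivAt_normal hy).const_smul μ)
  rw [this.fderiv, map_sub, map_smul, h.fderiv_shape hy hd]
  simp

/-- Every vector is a combination of the focal maps and their derivatives. -/
theorem eq_focal_add_cofocal (h : IsHypersurfacePatch F N U)
    (hd : Module.finrank ℝ W = Module.finrank ℝ V + 2) (hy : y ∈ U) (w : W) :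
    w = (1 + μ ^ 2)⁻¹ •
      (⟪focal F N μ y, w⟫ • focal F N μ y +
        μ • fderiv ℝ (focal F N μ) y (tangentPart F N y w)) +
      (1 + μ ^ 2)⁻¹ • (⟪cofocal F N μ y, w⟫ • cofocal F N μ y +
        fderiv ℝ (cofocal F N μ) y (tangentPart F N y w)) := by
  have h0 : (1 + μ ^ 2) ≠ 0 := by positivity
  have h1 := h.fderiv_tangentPart hy hd w
  rw [← smul_add, eq_inv_smul_iff₀ h0, h.fderiv_focal_apply hd hy, h.fderiv_cofocal_apply hd hy]
  simp only [map_add, map_sub, map_smul, h1, focal, cofocal, inner_add_left, inner_sub_left,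
    inner_smul_left, RCLike.conj_to_real]
  module

theorem inner_fderiv_focal_fderiv_cofocal (h : IsHypersurfacePatch F N U)
    (hd : Module.finrank ℝ W = Module.finrank ℝ V + 2) (hy : y ∈ U)
    (hS : (shape F N y + μ • 1) * (1 - μ • shape F N y) = 0) (a b : V) :
    ⟪fderiv ℝ (focal F N μ) y a, fderiv ℝ (cofocal F N μ) y b⟫ = 0 := by
  rw [h.fderiv_focal_apply hd hy, h.fderiv_cofocal_apply hd hy, map_add, inner_add_left,
    h.inner_fderiv_shape hy hd, map_smul, inner_smul_left, RCLike.conj_to_real,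
    ← real_inner_smul_right, ← inner_add_right, ← map_smul (fderiv ℝ F y), ← map_add]
  have : shape F N y (b - μ • shape F N y b) + μ • (b - μ • shape F N y b) = 0 := by
    simpa using DFunLike.congr_fun hS b
  rw [this, map_zero, inner_zero_right]

theorem focalProj_focal (h : IsHypersurfacePatch F N U)
    (hd : Module.finrank ℝ W = Module.finrank ℝ V + 2) (hy : y ∈ U) :
    focalProj F N μ y (focal F N μ y) = focal F N μ y := by
  have h0 : (1 + μ ^ 2) ≠ 0 := by positivity
  rw [focalProj_apply, h.inner_focal_self hy]
  simp [focal, h.tangentPart_position hy hd, h.tangentPart_normal hy hd, smul_smul, h0]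

theorem focalProj_cofocal (h : IsHypersurfacePatch F N U)
    (hd : Module.finrank ℝ W = Module.finrank ℝ V + 2) (hy : y ∈ U) :
    focalProj F N μ y (cofocal F N μ y) = 0 := by
  rw [focalProj_apply, h.inner_focal_cofocal hy]
  simp [cofocal, h.tangentPart_position hy hd, h.tangentPart_normal hy hd]

theorem focalProj_eq_zero (h : IsHypersurfacePatch F N U)
    (hd : Module.finrank ℝ W = Module.finrank ℝ V + 2) (hy : y ∈ U)
    (hS : (shape F N y + μ • 1) * (1 - μ • shape F N y) = 0) {w : W}
    (h0 : ⟪focal F N μ y, w⟫ = 0) (h1 : ∀ a, ⟪fderiv ℝ (focal F N μ) y a, w⟫ = 0) :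
    focalProj F N μ y w = 0 := by
  have h2 := h.eq_focal_add_cofocal (μ := μ) hd hy w
  rw [← focalProj_apply] at h2
  have h3 : ⟪focalProj F N μ y w, w⟫ = 0 := by
    rw [focalProj_apply, inner_smul_left, inner_add_left, inner_smul_left, inner_smul_left, h0, h1]
    simp
  have h4 : ⟪focalProj F N μ y w, (1 + μ ^ 2)⁻¹ • (⟪cofocal F N μ y, w⟫ • cofocal F N μ y +
        fderiv ℝ (cofocal F N μ) y (tangentPart F N y w))⟫ = 0 := by
    rw [focalProj_apply, inner_smul_left, inner_add_left, inner_smul_left, inner_smul_left,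
      inner_smul_right, inner_smul_right, inner_add_right, inner_add_right, inner_smul_right,
      inner_smul_right, h.inner_focal_cofocal hy, h.inner_fderiv_focal_fderiv_cofocal hd hy hS,
      h.fderiv_cofocal_apply hd hy, h.inner_focal_fderiv hy, real_inner_comm (cofocal F N μ y),
      h.fderiv_focal_apply hd hy, h.inner_cofocal_fderiv hy]
    simp
  exact eq_zero_of_inner_eq_zero_of_eq_add h2 h3 h4

theorem focalProj_eq_self (h : IsHypersurfacePatch F N U)
    (hd : Module.finrank ℝ W = Module.finrank ℝ V + 2) (hy : y ∈ U)
    (hS : (shape F N y + μ • 1) * (1 - μ • shape F N y) = 0) {w : W}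
    (h0 : ⟪cofocal F N μ y, w⟫ = 0) (h1 : ∀ a, ⟪fderiv ℝ (cofocal F N μ) y a, w⟫ = 0) :
    focalProj F N μ y w = w := by
  have h2 := h.eq_focal_add_cofocal (μ := μ) hd hy w
  rw [← focalProj_apply, h0, zero_smul, zero_add] at h2
  have h3 : ⟪(1 + μ ^ 2)⁻¹ • fderiv ℝ (cofocal F N μ) y (tangentPart F N y w), w⟫ = 0 := by
    rw [inner_smul_left, h1]
    simp
  have h4 : ⟪(1 + μ ^ 2)⁻¹ • fderiv ℝ (cofocal F N μ) y (tangentPart F N y w),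
      focalProj F N μ y w⟫ = 0 := by
    rw [real_inner_comm, focalProj_apply, inner_smul_left, inner_add_left, inner_smul_left,
      inner_smul_left, inner_smul_right, inner_smul_right,
      h.inner_fderiv_focal_fderiv_cofocal hd hy hS,
      h.fderiv_cofocal_apply hd hy, h.inner_focal_fderiv hy]
    simp
  have h5 := eq_zero_of_inner_eq_zero_of_eq_add (h2.trans (add_comm _ _)) h3 h4
  rw [h5, add_zero] at h2
  exact h2.symm

theorem inner_second_fderiv_focal (h : IsHypersurfacePatch F N U)
    (hd : Module.finrank ℝ W = Module.finrank ℝ V + 2)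
    (hS : ∀ z ∈ U, (shape F N z + μ • 1) * (1 - μ • shape F N z) = 0) (hy : y ∈ U) (a b c : V) :
    ⟪fderiv ℝ (fderiv ℝ (focal F N μ)) y a b, fderiv ℝ (cofocal F N μ) y c⟫ =
      -⟪fderiv ℝ (focal F N μ) y b, fderiv ℝ (fderiv ℝ (cofocal F N μ)) y a c⟫ := by
  have h1 := (((h.hasFDerivAt_fderiv_focal hy).clm_apply (hasFDerivAt_const b y)).inner ℝ
    ((h.hasFDerivAt_fderiv_cofocal hy).clm_apply (hasFDerivAt_const c y))).eq_of_eqOn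
    (hasFDerivAt_const (0 : ℝ) y) h.isOpen hy
    (fun z hz ↦ h.inner_fderiv_focal_fderiv_cofocal (μ := μ) hd hz (hS z hz) b c)
  have h2 := DFunLike.congr_fun h1 a
  simp [fderivInnerCLM_apply] at h2
  linarith

/-- The trilinear form `⟨D²η(a, b), dζ(c)⟩` of the focal maps `η`, `ζ` vanishes. -/
theorem inner_second_fderiv_focal_eq_zero (h : IsHypersurfacePatch F N U)
    (hd : Module.finrank ℝ W = Module.finrank ℝ V + 2)
    (hS : ∀ z ∈ U, (shape F N z + μ • 1) * (1 - μ • shape F N z) = 0) (hy : y ∈ U) (a b c : V) :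
    ⟪fderiv ℝ (fderiv ℝ (focal F N μ)) y a b, fderiv ℝ (cofocal F N μ) y c⟫ = 0 := by
  have h0 : (1 + μ ^ 2) ≠ 0 := by positivity
  have hS' : (1 - μ • shape F N y) * (shape F N y + μ • 1) = 0 := by
    rw [← hS y hy]
    simp only [add_mul, mul_add, sub_mul, mul_sub, smul_mul_assoc, mul_smul_comm, mul_one, one_mul,
      smul_sub, smul_add]
    abel
  have hsymm (a b c : V) :
      ⟪fderiv ℝ (fderiv ℝ (focal F N μ)) y a b, fderiv ℝ (cofocal F N μ) y c⟫ =
        ⟪fderiv ℝ (fderiv ℝ (focal F N μ)) y c b, fderiv ℝ (cofocal F N μ) y a⟫ := by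
    rw [h.inner_second_fderiv_focal hd hS hy, h.inner_second_fderiv_focal hd hS hy,
      h.second_fderiv_cofocal_symm hy]
  have hker (a b c : V) : ⟪fderiv ℝ (fderiv ℝ (focal F N μ)) y a b,
      fderiv ℝ (cofocal F N μ) y (shape F N y c + μ • c)⟫ = 0 := by
    have : shape F N y c + μ • c - μ • shape F N y (shape F N y c + μ • c) = 0 := by
      simpa using DFunLike.congr_fun hS' c
    rw [h.fderiv_cofocal_apply hd hy, this]
    simp
  have hker' (a b c : V) : ⟪fderiv ℝ (fderiv ℝ (focal F N μ)) y a (b - μ • shape F N y b),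
      fderiv ℝ (cofocal F N μ) y c⟫ = 0 := by
    have : shape F N y (b - μ • shape F N y b) + μ • (b - μ • shape F N y b) = 0 := by
      simpa using DFunLike.congr_fun (hS y hy) b
    rw [h.inner_second_fderiv_focal hd hS hy, h.fderiv_focal_apply hd hy, this]
    simp
  have hb : b = (1 + μ ^ 2)⁻¹ • (μ • (shape F N y b + μ • b) + (b - μ • shape F N y b)) := by
    rw [eq_inv_smul_iff₀ h0]
    module
  rw [hb, map_smul, map_add, inner_smul_left, inner_add_left, hker', map_smul, inner_smul_left,
    h.second_fderiv_focal_symm hy a, hsymm, hker]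
  simp

theorem hasFDerivAt_focalProj (h : IsHypersurfacePatch F N U)
    (hd : Module.finrank ℝ W = Module.finrank ℝ V + 2) (hy : y ∈ U) :
    HasFDerivAt (focalProj F N μ) (fderiv ℝ (focalProj F N μ) y) y := by
  refine DifferentiableAt.hasFDerivAt (ContDiffAt.differentiableAt (n := ∞) ?_ (by simp))
  have h1 : ContDiffAt ℝ ∞ (focal F N μ) y := h.contDiffAt_focal hy
  have h2 : ContDiffAt ℝ ∞ (fderiv ℝ (focal F N μ)) y := h1.fderiv_right (by simp)
  have h3 := h.contDiffAt_tangentPart hy hd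
  have h4 : ContDiffAt ℝ ∞ (fun z ↦ innerSL ℝ (focal F N μ z)) y :=
    (innerSL ℝ).contDiff.contDiffAt.comp y h1
  exact ((h4.smulRight h1).add ((h2.clm_comp h3).const_smul μ)).const_smul (1 + μ ^ 2)⁻¹

theorem fderiv_focalProj_eq_zero (h : IsHypersurfacePatch F N U)
    (hd : Module.finrank ℝ W = Module.finrank ℝ V + 2)
    (hS : ∀ z ∈ U, (shape F N z + μ • 1) * (1 - μ • shape F N z) = 0) (hy : y ∈ U) :
    fderiv ℝ (focalProj F N μ) y = 0 := by
  have hP := h.hasFDerivAt_focalProj (μ := μ) hd hy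
  have hη : HasFDerivAt (focal F N μ) _ y := h.hasFDerivAt_focal hy
  have hζ : HasFDerivAt (cofocal F N μ) _ y := h.hasFDerivAt_cofocal hy
  have hη' (b : V) := (h.hasFDerivAt_fderiv_focal (μ := μ) hy).clm_apply (hasFDerivAt_const b y)
  have hζ' (b : V) := (h.hasFDerivAt_fderiv_cofocal (μ := μ) hy).clm_apply (hasFDerivAt_const b y)
  have P1 {z : V} (hz : z ∈ U) (b : V) :
      focalProj F N μ z (fderiv ℝ (focal F N μ) z b) = fderiv ℝ (focal F N μ) z b := by
    refine h.focalProj_eq_self hd hz (hS z hz) ?_ (fun a ↦ ?_)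
    · rw [h.fderiv_focal_apply hd hz, h.inner_cofocal_fderiv hz]
    · rw [real_inner_comm, h.inner_fderiv_focal_fderiv_cofocal hd hz (hS z hz)]
  have P2 {z : V} (hz : z ∈ U) (b : V) :
      focalProj F N μ z (fderiv ℝ (cofocal F N μ) z b) = 0 := by
    refine h.focalProj_eq_zero hd hz (hS z hz) ?_ (fun a ↦ ?_)
    · rw [h.fderiv_cofocal_apply hd hz, h.inner_focal_fderiv hz]
    · rw [h.inner_fderiv_focal_fderiv_cofocal hd hz (hS z hz)]
  have P3 (a b : V) : focalProj F N μ y (fderiv ℝ (fderiv ℝ (focal F N μ)) y a b) =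
      fderiv ℝ (fderiv ℝ (focal F N μ)) y a b := by
    refine h.focalProj_eq_self hd hy (hS y hy) ?_ (fun c ↦ ?_)
    · have h1 := (hζ.inner ℝ (hη' b)).eq_of_eqOn (hasFDerivAt_const (0 : ℝ) y) h.isOpen hy
        (fun z hz ↦ by rw [h.fderiv_focal_apply hd hz, h.inner_cofocal_fderiv hz])
      have h2 := DFunLike.congr_fun h1 a
      simp [fderivInnerCLM_apply] at h2
      rwa [real_inner_comm (fderiv ℝ (focal F N μ) y b),
        h.inner_fderiv_focal_fderiv_cofocal hd hy (hS y hy), add_zero] at h2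
    · rw [real_inner_comm, h.inner_second_fderiv_focal_eq_zero hd hS hy]
  have P4 (a b : V) : focalProj F N μ y (fderiv ℝ (fderiv ℝ (cofocal F N μ)) y a b) = 0 := by
    refine h.focalProj_eq_zero hd hy (hS y hy) ?_ (fun c ↦ ?_)
    · have h1 := (hη.inner ℝ (hζ' b)).eq_of_eqOn (hasFDerivAt_const (0 : ℝ) y) h.isOpen hy
        (fun z hz ↦ by rw [h.fderiv_cofocal_apply hd hz, h.inner_focal_fderiv hz])
      have h2 := DFunLike.congr_fun h1 a
      simp [fderivInnerCLM_apply] at h2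
      rwa [h.inner_fderiv_focal_fderiv_cofocal hd hy (hS y hy), add_zero] at h2
    · rw [← neg_eq_zero, ← h.inner_second_fderiv_focal hd hS hy,
        h.inner_second_fderiv_focal_eq_zero hd hS hy]
  ext a w
  have Q1 : fderiv ℝ (focalProj F N μ) y a (focal F N μ y) = 0 := by
    have h1 := (hP.clm_apply hη).eq_of_eqOn hη h.isOpen hy (fun z hz ↦ h.focalProj_focal hd hz)
    simpa [P1 hy] using DFunLike.congr_fun h1 a
  have Q2 : fderiv ℝ (focalProj F N μ) y a (cofocal F N μ y) = 0 := by
    have h1 := (hP.clm_apply hζ).eq_of_eqOn (hasFDerivAt_const (0 : W) y) h.isOpen hy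
      (fun z hz ↦ h.focalProj_cofocal hd hz)
    simpa [P2 hy] using DFunLike.congr_fun h1 a
  have Q3 (b : V) : fderiv ℝ (focalProj F N μ) y a (fderiv ℝ (focal F N μ) y b) = 0 := by
    have h1 := (hP.clm_apply (hη' b)).eq_of_eqOn (hη' b) h.isOpen hy (fun z hz ↦ P1 hz b)
    simpa [P3] using DFunLike.congr_fun h1 a
  have Q4 (b : V) : fderiv ℝ (focalProj F N μ) y a (fderiv ℝ (cofocal F N μ) y b) = 0 := by
    have h1 := (hP.clm_apply (hζ' b)).eq_of_eqOn (hasFDerivAt_const (0 : W) y) h.isOpen hy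
      (fun z hz ↦ P2 hz b)
    simpa [P4] using DFunLike.congr_fun h1 a
  rw [h.eq_focal_add_cofocal (μ := μ) hd hy w]
  simp [Q1, Q2, Q3, Q4]

/-- The span of the focal map and its first derivatives. -/
noncomputable def focalSpace (F N : V → W) (μ : ℝ) (y : V) : Submodule ℝ W :=
  ℝ ∙ focal F N μ y ⊔ (fderiv ℝ (focal F N μ) y).range

theorem focalSpace_eq_range (h : IsHypersurfacePatch F N U)
    (hd : Module.finrank ℝ W = Module.finrank ℝ V + 2)
    (hS : ∀ z ∈ U, (shape F N z + μ • 1) * (1 - μ • shape F N z) = 0) (hy : y ∈ U) :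
    focalSpace F N μ y = (focalProj F N μ y).range := by
  apply le_antisymm
  · refine sup_le ?_ ?_
    · rw [Submodule.span_singleton_le_iff_mem]
      exact ⟨_, h.focalProj_focal hd hy⟩
    · rintro _ ⟨b, rfl⟩
      refine ⟨fderiv ℝ (focal F N μ) y b, h.focalProj_eq_self hd hy (hS y hy) ?_ (fun a ↦ ?_)⟩
      · rw [h.fderiv_focal_apply hd hy, h.inner_cofocal_fderiv hy]
      · rw [real_inner_comm]
        exact h.inner_fderiv_focal_fderiv_cofocal hd hy (hS y hy) _ _
  · rintro _ ⟨w, rfl⟩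
    rw [ContinuousLinearMap.coe_coe, focalProj_apply]
    refine Submodule.smul_mem _ _ (Submodule.add_mem_sup ?_ ?_)
    · exact Submodule.smul_mem _ _ (Submodule.mem_span_singleton_self _)
    · exact Submodule.smul_mem _ _ ⟨_, rfl⟩

/-- If `-μ` and `1 / μ` are the only principal curvatures, then the focal space is locally
constant. -/
theorem focalSpace_eq (h : IsHypersurfacePatch F N U)
    (hd : Module.finrank ℝ W = Module.finrank ℝ V + 2)
    (hS : ∀ z ∈ U, (shape F N z + μ • 1) * (1 - μ • shape F N z) = 0) (hU : IsPreconnected U)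
    {z : V} (hy : y ∈ U) (hz : z ∈ U) : focalSpace F N μ y = focalSpace F N μ z := by
  rw [h.focalSpace_eq_range hd hS hy, h.focalSpace_eq_range hd hS hz,
    h.isOpen.is_const_of_fderiv_eq_zero hU
      (fun x hx ↦ (h.hasFDerivAt_focalProj hd hx).differentiableAt.differentiableWithinAt)
      (fun x hx ↦ h.fderiv_focalProj_eq_zero hd hS hx) hy hz]

end IsHypersurfacePatch

/-- In a complete metric space, if a path can be lifted for a short time with speed at most `L`
starting from any point over it, then it can be lifted for all positive time. -/
theorem exists_lift_endpoint_of_forall_short_lift {M X : Type*} [MetricSpace M] [CompleteSpace M]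
    [TopologicalSpace X] [T2Space X] {f : M → X} (hf : Continuous f) {p : ℝ → X}
    (hp : Continuous p) {L : ℝ} (hL : 0 ≤ L)
    (hloc : ∀ t x, f x = p t → ∀ b > t, ∃ s ∈ Set.Ioc t b, ∃ y, f y = p s ∧ dist x y ≤ L * (s - t))
    {a b : ℝ} (hab : a ≤ b) {x : M} (hx : f x = p a) : ∃ y, f y = p b := by
  let Z := {z : ℝ × M // z.1 ≤ b ∧ f z.2 = p z.1}
  let r : Z → Z → Prop := fun z w ↦ z.1.1 ≤ w.1.1 ∧ dist z.1.2 w.1.2 ≤ L * (w.1.1 - z.1.1)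
  have hr : ∀ z, r z z := fun z ↦ by simp [r]
  obtain ⟨m, hm⟩ := exists_maximal_of_chains_bounded (r := r) (fun c hc ↦ by
    rcases c.eq_empty_or_nonempty with rfl | hne
    · exact ⟨⟨(a, x), hab, hx⟩, by simp⟩
    have hdist : ∀ z ∈ c, ∀ w ∈ c, dist z.1.2 w.1.2 ≤ L * dist z.1.1 w.1.1 := by
      have key (z w : Z) (h : r z w) : dist z.1.2 w.1.2 ≤ L * dist z.1.1 w.1.1 := by
        rw [dist_comm z.1.1, Real.dist_eq, abs_of_nonneg (sub_nonneg.2 h.1)]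
        exact h.2
      intro z hz w hw
      by_cases hzw : z = w
      · simp [hzw]
      rcases hc hz hw hzw with h | h
      · exact key z w h
      · rw [dist_comm, dist_comm z.1.1]
        exact key w z h
    let S : Set ℝ := (fun z : Z ↦ z.1.1) '' c
    have hSb : BddAbove S := ⟨b, by rintro _ ⟨z, -, rfl⟩; exact z.2.1⟩
    obtain ⟨u, -, hu, huS⟩ := exists_seq_tendsto_sSup (hne.image _) hSb
    choose z hzc hzu using huS
    have hdz (n k : ℕ) : dist (z n).1.2 (z k).1.2 ≤ L * dist (u n) (u k) := by
      rw [← hzu, ← hzu]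
      exact hdist _ (hzc n) _ (hzc k)
    have hcau : CauchySeq (fun n ↦ (z n).1.2) := by
      rw [Metric.cauchySeq_iff']
      intro ε hε
      obtain ⟨n, hn⟩ := Metric.cauchySeq_iff'.1 hu.cauchySeq (ε / (L + 1)) (by positivity)
      refine ⟨n, fun k hk ↦ (hdz k n).trans_lt ?_⟩
      have h1 := hn k hk
      rw [lt_div_iff₀ (by positivity)] at h1
      nlinarith [dist_nonneg (x := u k) (y := u n)]
    obtain ⟨y, hy⟩ := cauchySeq_tendsto_of_complete hcau
    have hyS : f y = p (sSup S) := by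
      refine tendsto_nhds_unique ((hf.tendsto y).comp hy) (((hp.tendsto _).comp hu).congr ?_)
      intro n
      simp only [Function.comp_apply]
      rw [← hzu]
      exact (z n).2.2.symm
    refine ⟨⟨(sSup S, y), csSup_le (hne.image _) (by rintro _ ⟨z, -, rfl⟩; exact z.2.1), hyS⟩,
      fun w hw ↦ ?_⟩
    have hwS : w.1.1 ≤ sSup S := le_csSup hSb ⟨w, hw, rfl⟩
    refine ⟨hwS, ?_⟩
    have h1 : dist w.1.2 y ≤ L * dist w.1.1 (sSup S) := by
      refine le_of_tendsto_of_tendsto' (tendsto_const_nhds.dist hy)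
        ((tendsto_const_nhds.dist hu).const_mul L) (fun n ↦ ?_)
      rw [← hzu]
      exact hdist _ hw _ (hzc n)
    rwa [dist_comm w.1.1, Real.dist_eq, abs_of_nonneg (sub_nonneg.2 hwS)] at h1)
    (fun {z w k} h1 h2 ↦ ⟨h1.1.trans h2.1, by
      have h3 := dist_triangle z.1.2 w.1.2 k.1.2
      have h4 := h1.2
      have h5 := h2.2
      linarith⟩)
  rcases m.2.1.lt_or_eq with hlt | heq
  · obtain ⟨s, hs, y, hy, hd⟩ := hloc m.1.1 m.1.2 m.2.2 b hlt
    have h1 := hm ⟨(s, y), hs.2, hy⟩ ⟨hs.1.le, hd⟩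
    exact absurd h1.1 (not_le.2 hs.1)
  · exact ⟨m.1.2, by rw [m.2.2, heq]⟩

namespace IsHypersurfacePatch

variable {V W : Type*} [NormedAddCommGroup V] [NormedSpace ℝ V]
  [NormedAddCommGroup W] [InnerProductSpace ℝ W]
  [FiniteDimensional ℝ V] [FiniteDimensional ℝ W]
variable {F N : V → W} {U : Set V} {y : V}

/-- A linear vector field tangent to the hypersurface has integral curves on it. -/
theorem exists_integralCurve (h : IsHypersurfacePatch F N U)
    (hd : Module.finrank ℝ W = Module.finrank ℝ V + 2) (K : W →L[ℝ] W)
    (hF : ∀ z ∈ U, ⟪F z, K (F z)⟫ = 0) (hN : ∀ z ∈ U, ⟪N z, K (F z)⟫ = 0) (hy : y ∈ U) (t₀ : ℝ) :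
    ∃ α : ℝ → V, α t₀ = y ∧ ∃ ε > 0, (∀ t ∈ Set.Ioo (t₀ - ε) (t₀ + ε), α t ∈ U) ∧
      ContDiffOn ℝ 1 α (Set.Ioo (t₀ - ε) (t₀ + ε)) ∧
      ∀ t ∈ Set.Ioo (t₀ - ε) (t₀ + ε), HasDerivAt (F ∘ α) (K (F (α t))) t := by
  let G : V → V := fun z ↦ tangentPart F N z (K (F z))
  have hG {z : V} (hz : z ∈ U) : ContDiffAt ℝ ∞ G z :=
    (h.contDiffAt_tangentPart hz hd).clm_apply (K.contDiff.contDiffAt.comp z (h.contDiffAt hz))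
  have hdG {z : V} (hz : z ∈ U) : fderiv ℝ F z (G z) = K (F z) := by
    rw [h.fderiv_tangentPart hz hd, hF z hz, hN z hz]
    simp
  obtain ⟨α, hα0, ε, hε, hα⟩ :=
    ((hG hy).of_le (m := 1) (by simp)).exists_forall_mem_closedBall_exists_eq_forall_mem_Ioo_hasDerivAt₀ t₀
  have hαU : ∀ᶠ t in nhds t₀, α t ∈ U :=
    (hα t₀ (by simp [hε])).continuousAt.eventually_mem (by
      rw [hα0]; exact h.isOpen.mem_nhds hy)
  obtain ⟨δ, hδ, hδU⟩ := Metric.eventually_nhds_iff_ball.1 hαU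
  rw [Real.ball_eq_Ioo] at hδU
  have hsub1 : Set.Ioo (t₀ - min ε δ) (t₀ + min ε δ) ⊆ Set.Ioo (t₀ - ε) (t₀ + ε) :=
    Set.Ioo_subset_Ioo (by linarith [min_le_left ε δ]) (by linarith [min_le_left ε δ])
  have hsub2 : Set.Ioo (t₀ - min ε δ) (t₀ + min ε δ) ⊆ Set.Ioo (t₀ - δ) (t₀ + δ) :=
    Set.Ioo_subset_Ioo (by linarith [min_le_right ε δ]) (by linarith [min_le_right ε δ])
  refine ⟨α, hα0, min ε δ, lt_min hε hδ, fun t ht ↦ hδU t (hsub2 ht), ?_, fun t ht ↦ ?_⟩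
  · rw [show (1 : WithTop ℕ∞) = 0 + 1 from rfl, contDiffOn_succ_iff_deriv_of_isOpen isOpen_Ioo]
    refine ⟨fun t ht ↦ (hα t (hsub1 ht)).differentiableAt.differentiableWithinAt, by simp, ?_⟩
    rw [contDiffOn_zero]
    have : ContinuousOn (G ∘ α) (Set.Ioo (t₀ - min ε δ) (t₀ + min ε δ)) := fun t ht ↦
      ((hG (hδU t (hsub2 ht))).continuousAt.comp
        (hα t (hsub1 ht)).continuousAt).continuousWithinAt
    exact this.congr (fun t ht ↦ (hα t (hsub1 ht)).deriv)
  · rw [← hdG (hδU t (hsub2 ht))]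
    exact (h.hasFDerivAt (hδU t (hsub2 ht))).comp_hasDerivAt t (hα t (hsub1 ht))

end IsHypersurfacePatch

section Chart

variable {n : ℕ} {M : Type*} [TopologicalSpace M] [ChartedSpace (EuclideanSpace ℝ (Fin n)) M]
  [IsManifold (𝓡 n) ∞ M]

/-- In a chart, all derivatives of vector-valued functions are obtained from the intrinsic ones by
the same linear isomorphism. -/
theorem exists_equiv_fderiv_comp_extChartAt_symm {W : Type*} [NormedAddCommGroup W]
    [NormedSpace ℝ W] (x₀ : M) {y : EuclideanSpace ℝ (Fin n)}
    (hy : y ∈ (extChartAt (𝓡 n) x₀).target) :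
    ∃ T : EuclideanSpace ℝ (Fin n) ≃L[ℝ] TangentSpace (𝓡 n) ((extChartAt (𝓡 n) x₀).symm y),
      ∀ f : M → W, MDifferentiableAt (𝓡 n) 𝓘(ℝ, W) f ((extChartAt (𝓡 n) x₀).symm y) →
        ∀ w, fderiv ℝ (f ∘ (extChartAt (𝓡 n) x₀).symm) y w =
          mvfderiv (𝓡 n) f ((extChartAt (𝓡 n) x₀).symm y) (T w) := by
  have : IsManifold (𝓡 n) 1 M := IsManifold.of_le (n := ∞) (by simp)
  obtain ⟨T, hT⟩ := isInvertible_mfderivWithin_extChartAt_symm hy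
  refine ⟨T, fun f hf w ↦ ?_⟩
  have h1 := mdifferentiableWithinAt_extChartAt_symm hy
  rw [ModelWithCorners.Boundaryless.range_eq_univ, mfderivWithin_univ] at hT
  rw [ModelWithCorners.Boundaryless.range_eq_univ, mdifferentiableWithinAt_univ] at h1
  have h2 := mfderiv_comp y hf h1
  rw [mfderiv_eq_fderiv] at h2
  rw [h2, ← hT]
  rfl

variable {φ : M → UnitSphere n} {ν : M → Ambient n}

/-- The composition of a function with the inverse of a chart. -/
noncomputable def chartRep {W : Type*} (f : M → W) (x₀ : M) : EuclideanSpace ℝ (Fin n) → W :=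
  f ∘ (extChartAt (𝓡 n) x₀).symm

theorem contDiffOn_chartRep {W : Type*} [NormedAddCommGroup W] [NormedSpace ℝ W] {f : M → W}
    (hf : ContMDiff (𝓡 n) 𝓘(ℝ, W) ∞ f) (x₀ : M) :
    ContDiffOn ℝ ∞ (chartRep f x₀) (extChartAt (𝓡 n) x₀).target :=
  contMDiffOn_iff_contDiffOn.1 (hf.comp_contMDiffOn (contMDiffOn_extChartAt_symm x₀))

theorem isHypersurfacePatch_chartRep (hφ : ContMDiff (𝓡 n) 𝓘(ℝ, Ambient n) ∞ (position φ))
    (hinj : ∀ x, Function.Injective (dPosition φ x)) (hν : IsGaussMap φ ν) (x₀ : M) :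
    IsHypersurfacePatch (chartRep (position φ) x₀) (chartRep ν x₀)
      (extChartAt (𝓡 n) x₀).target where
  isOpen := isOpen_extChartAt_target x₀
  contDiffOn := contDiffOn_chartRep hφ x₀
  contDiffOn_normal := contDiffOn_chartRep hν.smooth x₀
  norm_eq_one y _ := norm_eq_of_mem_sphere (φ ((extChartAt (𝓡 n) x₀).symm y))
  norm_normal y _ := hν.norm_eq_one _
  inner_normal y _ := hν.inner_position _
  inner_normal_fderiv y hy w := by
    obtain ⟨T, hT⟩ := exists_equiv_fderiv_comp_extChartAt_symm (W := Ambient n) x₀ hy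
    rw [chartRep, chartRep, hT _ ((hφ _).mdifferentiableAt (by simp))]
    exact hν.inner_tangent _ _
  injective_fderiv y hy := by
    obtain ⟨T, hT⟩ := exists_equiv_fderiv_comp_extChartAt_symm (W := Ambient n) x₀ hy
    intro a b hab
    rw [chartRep, hT _ ((hφ _).mdifferentiableAt (by simp)),
      hT _ ((hφ _).mdifferentiableAt (by simp))] at hab
    exact T.injective (hinj _ hab)

theorem finrank_ambient : Module.finrank ℝ (Ambient n) =
    Module.finrank ℝ (EuclideanSpace ℝ (Fin n)) + 2 := by
  simp

theorem trace_shape_chartRep (hn : 1 ≤ n)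
    (hφ : ContMDiff (𝓡 n) 𝓘(ℝ, Ambient n) ∞ (position φ))
    (hinj : ∀ x, Function.Injective (dPosition φ x)) (hν : IsGaussMap φ ν) (x₀ : M)
    {y : EuclideanSpace ℝ (Fin n)} (hy : y ∈ (extChartAt (𝓡 n) x₀).target) :
    ContinuousLinearMap.traceCLM _
        (IsHypersurfacePatch.shape (chartRep (position φ) x₀) (chartRep ν x₀) y) =
      n * meanCurvature φ ν ((extChartAt (𝓡 n) x₀).symm y) := by
  have h := isHypersurfacePatch_chartRep hφ hinj hν x₀
  obtain ⟨x, T, hT, hx⟩ : ∃ x, ∃ T : EuclideanSpace ℝ (Fin n) ≃L[ℝ] TangentSpace (𝓡 n) x,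
      (∀ f : M → Ambient n, MDifferentiableAt (𝓡 n) 𝓘(ℝ, Ambient n) f x → ∀ w,
        fderiv ℝ (f ∘ (extChartAt (𝓡 n) x₀).symm) y w = mvfderiv (𝓡 n) f x (T w)) ∧
      (extChartAt (𝓡 n) x₀).symm y = x := by
    obtain ⟨T, hT⟩ := exists_equiv_fderiv_comp_extChartAt_symm (W := Ambient n) x₀ hy
    exact ⟨_, T, hT, rfl⟩
  rw [hx]
  set S := IsHypersurfacePatch.shape (chartRep (position φ) x₀) (chartRep ν x₀) y
  have hS : shapeOperator φ ν x = T.toLinearEquiv.conj S.toLinearMap := by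
    ext w
    have h1 := h.fderiv_shape hy finrank_ambient (T.symm w)
    rw [chartRep, chartRep, hT _ ((hφ _).mdifferentiableAt (by simp)),
      hT _ ((hν.smooth _).mdifferentiableAt (by simp)), T.apply_symm_apply] at h1
    have h2 : mvfderiv (𝓡 n) ν x w = -(dPosition φ x (T (S (T.symm w)))) := by
      rw [eq_neg_iff_add_eq_zero, ← neg_eq_iff_add_eq_zero]
      exact h1.symm
    have h3 : (dPosition φ x).toLinearMap.leftInverse (dPosition φ x (T (S (T.symm w)))) =
        T (S (T.symm w)) :=
      LinearMap.leftInverse_apply_of_inj (LinearMap.ker_eq_bot.2 (hinj x)) _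
    change -((dPosition φ x).toLinearMap.leftInverse (mvfderiv (𝓡 n) ν x w)) = T (S (T.symm w))
    rw [h2, map_neg, h3, neg_neg]
  have hn0 : (n : ℝ) ≠ 0 := by positivity
  rw [meanCurvature, hS, mul_div_cancel₀ _ hn0, ContinuousLinearMap.traceCLM_apply]
  exact (LinearMap.trace_conj' _ _).symm

end Chart

section Riemannian

variable {n : ℕ} {M : Type*} [MetricSpace M] [ChartedSpace (EuclideanSpace ℝ (Fin n)) M]
  [Bundle.RiemannianBundle (fun x : M ↦ TangentSpace (𝓡 n) x)]
  [IsRiemannianManifold (𝓡 n) M]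
variable {φ : M → UnitSphere n} {ν : M → Ambient n}

/-- The distance between the endpoints of a curve whose image in the ambient space has speed at
most `L`. -/
theorem dist_le_of_norm_deriv_position_le
    (hφ : ContMDiff (𝓡 n) 𝓘(ℝ, Ambient n) ∞ (position φ))
    (hmetric : ∀ (x : M) (w z : TangentSpace (𝓡 n) x),
      ⟪w, z⟫ = ⟪dPosition φ x w, dPosition φ x z⟫)
    {γ : ℝ → M} {a b L : ℝ} (hab : a ≤ b) {s : Set ℝ} (hs : IsOpen s) (habs : Set.Icc a b ⊆ s)
    (hγ : ContMDiffOn 𝓘(ℝ, ℝ) (𝓡 n) 1 γ s)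
    (hL : ∀ t ∈ Set.Icc a b, ‖deriv (position φ ∘ γ) t‖ ≤ L) :
    dist (γ a) (γ b) ≤ L * (b - a) := by
  have hL0 : 0 ≤ L := (norm_nonneg _).trans (hL a ⟨le_rfl, hab⟩)
  have hnorm (x : M) (w : TangentSpace (𝓡 n) x) : ‖w‖ = ‖dPosition φ x w‖ := by
    rw [@norm_eq_sqrt_real_inner, hmetric, ← norm_eq_sqrt_real_inner]
  have h1 : edist (γ a) (γ b) ≤ ENNReal.ofReal (L * (b - a)) := by
    rw [IsRiemannianManifold.out (I := 𝓡 n) (γ a) (γ b)]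
    refine (Manifold.riemannianEDist_le_pathELength (hγ.mono habs) rfl rfl hab).trans ?_
    rw [Manifold.pathELength_eq_lintegral_mfderiv_Icc]
    calc _ ≤ ∫⁻ _ in Set.Icc a b, ENNReal.ofReal L := by
          refine MeasureTheory.setLIntegral_mono measurable_const (fun t ht ↦ ?_)
          rw [← ofReal_norm]
          refine ENNReal.ofReal_le_ofReal ?_
          refine le_trans (le_of_eq ?_) (hL t ht)
          rw [hnorm]
          have hd : MDifferentiableAt 𝓘(ℝ, ℝ) (𝓡 n) γ t :=
            ((hγ t (habs ht)).contMDiffAt (hs.mem_nhds (habs ht))).mdifferentiableAt (by simp)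
          have h2 := mfderiv_comp t ((hφ (γ t)).mdifferentiableAt (by simp)) hd
          rw [mfderiv_eq_fderiv] at h2
          rw [← fderiv_apply_one_eq_deriv, h2]
          rfl
      _ = ENNReal.ofReal (L * (b - a)) := by
          rw [MeasureTheory.setLIntegral_const, Real.volume_Icc, ← ENNReal.ofReal_mul hL0]
  rw [edist_dist] at h1
  exact (ENNReal.ofReal_le_ofReal_iff (by nlinarith)).1 h1

/-- A complete hypersurface contains the positive orbits of the linear vector fields tangent
to it. -/
theorem exists_position_eq_of_hasDerivAt [IsManifold (𝓡 n) ∞ M] [CompleteSpace M]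
    (hφ : ContMDiff (𝓡 n) 𝓘(ℝ, Ambient n) ∞ (position φ))
    (hmetric : ∀ (x : M) (w z : TangentSpace (𝓡 n) x),
      ⟪w, z⟫ = ⟪dPosition φ x w, dPosition φ x z⟫)
    (hinj : ∀ x, Function.Injective (dPosition φ x)) (hν : IsGaussMap φ ν)
    (K : Ambient n →L[ℝ] Ambient n) (hK : ∀ w, ⟪w, K w⟫ = 0)
    (hKν : ∀ x, ⟪ν x, K (position φ x)⟫ = 0) {p : ℝ → Ambient n}
    (hp : ∀ t, HasDerivAt p (K (p t)) t) {a b : ℝ} (hab : a ≤ b) {x : M}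
    (hx : position φ x = p a) : ∃ y, position φ y = p b := by
  have hpc : Continuous p := continuous_iff_continuousAt.2 fun t ↦ (hp t).continuousAt
  refine exists_lift_endpoint_of_forall_short_lift hφ.continuous hpc (norm_nonneg K)
    (fun t x hx b hb ↦ ?_) hab hx
  have h := isHypersurfacePatch_chartRep hφ hinj hν x
  set e := extChartAt (𝓡 n) x
  obtain ⟨α, hα0, ε, hε, hαU, hα1, hα⟩ := h.exists_integralCurve finrank_ambient K
    (fun z _ ↦ hK _) (fun z _ ↦ hKν _) (mem_extChartAt_target x) t
  have heq : Set.EqOn (chartRep (position φ) x ∘ α) p (Set.Ioo (t - ε) (t + ε)) := by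
    refine ODE_solution_unique_of_mem_Ioo (v := fun _ ↦ K) (s := fun _ ↦ Set.univ) (K := ‖K‖₊)
      (t₀ := t) (fun _ _ ↦ K.lipschitz.lipschitzOnWith) (by simp [hε])
      (fun s hs ↦ ⟨hα s hs, trivial⟩) (fun s _ ↦ ⟨hp s, trivial⟩) ?_
    rw [← hx, Function.comp_apply, hα0]
    simp [chartRep]
  set s := min b (t + ε / 2) with hs
  have hts : t < s := lt_min hb (by linarith)
  have hsε : s < t + ε := (min_le_right _ _).trans_lt (by linarith)
  have hsub : Set.Icc t s ⊆ Set.Ioo (t - ε) (t + ε) := fun r hr ↦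
    ⟨by linarith [hr.1], hr.2.trans_lt hsε⟩
  have hγ : ContMDiffOn 𝓘(ℝ, ℝ) (𝓡 n) 1 (e.symm ∘ α) (Set.Ioo (t - ε) (t + ε)) :=
    ((contMDiffOn_extChartAt_symm (n := ∞) x).of_le (by simp)).comp
      hα1.contMDiffOn (fun r hr ↦ hαU r hr)
  refine ⟨s, ⟨hts, min_le_left _ _⟩, e.symm (α s), heq (hsub ⟨hts.le, le_rfl⟩), ?_⟩
  have hd := dist_le_of_norm_deriv_position_le (L := ‖K‖) hφ hmetric hts.le isOpen_Ioo hsub hγ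
    (fun r hr ↦ by
      have h1 := (hα r (hsub hr)).deriv
      have h2 := K.le_opNorm (chartRep (position φ) x (α r))
      rw [h.norm_eq_one _ (hαU r (hsub hr)), mul_one] at h2
      exact (congrArg norm h1).le.trans h2)
  rw [Function.comp_apply, Function.comp_apply, hα0] at hd
  simpa [e] using hd

end Riemannian

section Rotations

variable {W : Type*} [NormedAddCommGroup W] [InnerProductSpace ℝ W]

/-- `R` is invariant under the rotations in the planes contained in `E`. -/
def IsRotationInvariant (R : Set W) (E : Submodule ℝ W) : Prop :=
  ∀ a ∈ E, ∀ b ∈ E, ∀ y ∈ Eᗮ, ⟪a, b⟫ = 0 → ‖a‖ = ‖b‖ → a + y ∈ R →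
    ∀ t : ℝ, 0 ≤ t → Real.cos t • a + Real.sin t • b + y ∈ R

theorem Submodule.exists_mem_inner_eq_zero_norm_eq {E : Submodule ℝ W}
    (hE : 2 ≤ Module.finrank ℝ E) {a : W} (ha : a ∈ E) (ha0 : a ≠ 0) :
    ∃ b ∈ E, ⟪a, b⟫ = 0 ∧ ‖b‖ = ‖a‖ := by
  have hlt : ¬ E ≤ ℝ ∙ a := by
    intro hle
    have h1 := Submodule.finrank_mono hle
    rw [finrank_span_singleton ha0] at h1
    omega
  obtain ⟨e, he, hea⟩ := SetLike.not_le_iff_exists.1 hlt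
  have haa : ⟪a, a⟫ ≠ 0 := by simpa using ha0
  set w := e - (⟪a, e⟫ / ⟪a, a⟫) • a with hw
  have hw0 : w ≠ 0 := by
    intro h
    rw [hw, sub_eq_zero] at h
    exact hea (h ▸ Submodule.smul_mem _ _ (Submodule.mem_span_singleton_self a))
  have haw : ⟪a, w⟫ = 0 := by
    rw [hw, inner_sub_right, inner_smul_right, div_mul_cancel₀ _ haa, sub_self]
  refine ⟨(‖a‖ / ‖w‖) • w, E.smul_mem _ (E.sub_mem he (E.smul_mem _ ha)), ?_, ?_⟩
  · rw [inner_smul_right, haw, mul_zero]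
  · have : ‖w‖ ≠ 0 := norm_ne_zero_iff.2 hw0
    rw [norm_smul, Real.norm_of_nonneg (by positivity), div_mul_cancel₀ _ this]

/-- The rotations in the planes of `E` act transitively on the spheres of `E`. -/
theorem IsRotationInvariant.mem_of_norm_eq {R : Set W} {E : Submodule ℝ W}
    (h : IsRotationInvariant R E) (hE : 2 ≤ Module.finrank ℝ E) {a a' y : W} (ha : a ∈ E)
    (ha' : a' ∈ E) (hy : y ∈ Eᗮ) (hn : ‖a‖ = ‖a'‖) (hR : a + y ∈ R) : a' + y ∈ R := by
  by_cases ha0 : a = 0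
  · subst ha0
    rw [norm_zero, eq_comm, norm_eq_zero] at hn
    rwa [hn]
  have hna : ‖a‖ ≠ 0 := norm_ne_zero_iff.2 ha0
  have haa : ⟪a, a⟫ = ‖a‖ ^ 2 := real_inner_self_eq_norm_sq a
  set c := ⟪a, a'⟫ / ‖a‖ ^ 2 with hc
  set w := a' - c • a with hw
  have haw : ⟪a, w⟫ = 0 := by
    rw [hw, inner_sub_right, inner_smul_right, haa, hc]
    field_simp
    ring
  have hwE : w ∈ E := E.sub_mem ha' (E.smul_mem _ ha)
  obtain ⟨b, hb, hab, hbn, σ, hσ, hwb⟩ :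
      ∃ b ∈ E, ⟪a, b⟫ = 0 ∧ ‖b‖ = ‖a‖ ∧ ∃ σ : ℝ, 0 ≤ σ ∧ w = σ • b := by
    by_cases hw0 : w = 0
    · obtain ⟨b, hb, hab, hbn⟩ := Submodule.exists_mem_inner_eq_zero_norm_eq hE ha ha0
      exact ⟨b, hb, hab, hbn, 0, le_rfl, by rw [hw0, zero_smul]⟩
    · have hnw : ‖w‖ ≠ 0 := norm_ne_zero_iff.2 hw0
      refine ⟨(‖a‖ / ‖w‖) • w, E.smul_mem _ hwE, by rw [inner_smul_right, haw, mul_zero], ?_,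
        ‖w‖ / ‖a‖, by positivity, ?_⟩
      · rw [norm_smul, Real.norm_of_nonneg (by positivity), div_mul_cancel₀ _ hnw]
      · rw [smul_smul]
        field_simp
        simp
  have ha'eq : a' = c • a + σ • b := by rw [← hwb, hw]; abel
  have hsq : c ^ 2 + σ ^ 2 = 1 := by
    have h1 : ‖a'‖ ^ 2 = (c ^ 2 + σ ^ 2) * ‖a‖ ^ 2 := by
      have hba : ⟪b, a⟫ = 0 := by rw [real_inner_comm, hab]
      rw [← real_inner_self_eq_norm_sq, ha'eq]
      simp only [inner_add_left, inner_add_right, inner_smul_left, inner_smul_right, hab, hba, haa,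
        real_inner_self_eq_norm_sq, hbn, RCLike.conj_to_real]
      ring
    rw [← hn] at h1
    have : ‖a‖ ^ 2 ≠ 0 := by positivity
    exact mul_right_cancel₀ this (by linarith)
  have h1 := h a ha b hb y hy hab hbn.symm hR (Real.arccos c) (Real.arccos_nonneg c)
  rw [Real.cos_arccos (by nlinarith) (by nlinarith), Real.sin_arccos,
    show 1 - c ^ 2 = σ ^ 2 by linarith, Real.sqrt_sq hσ, ← ha'eq] at h1
  exact h1

end Rotations

namespace IsHypersurfacePatch

variable {V W : Type*} [NormedAddCommGroup V] [NormedSpace ℝ V]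
  [NormedAddCommGroup W] [InnerProductSpace ℝ W]
variable {F N : V → W} {U : Set V} {y : V} {u : W} {c : ℝ}

theorem abs_lt_one_of_inner_eq [Nontrivial V] (h : IsHypersurfacePatch F N U) (hu : ‖u‖ = 1)
    (hc : ∀ z ∈ U, ⟪F z, u⟫ = c) (hy : y ∈ U) : |c| < 1 := by
  have hle : |c| ≤ 1 := by
    rw [← hc y hy]
    simpa [h.norm_eq_one y hy, hu] using abs_real_inner_le_norm (F y) u
  refine lt_of_le_of_ne hle (fun hc1 ↦ ?_)
  have hc2 : c ^ 2 = 1 := by rw [← sq_abs, hc1, one_pow]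
  have hF : ∀ z ∈ U, F z = c • u := by
    intro z hz
    rw [← sub_eq_zero, ← norm_eq_zero, ← sq_eq_zero_iff, norm_sub_sq_real, inner_smul_right, hc z hz,
      norm_smul, h.norm_eq_one z hz, hu, Real.norm_eq_abs, hc1]
    linarith
  have h1 := (h.hasFDerivAt hy).eq_of_eqOn (hasFDerivAt_const (c • u) y) h.isOpen hy hF
  obtain ⟨w, hw⟩ := exists_ne (0 : V)
  exact hw (h.injective_fderiv y hy (by simp [h1]))

theorem eq_of_inner_eq [FiniteDimensional ℝ V] [FiniteDimensional ℝ W]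
    (h : IsHypersurfacePatch F N U) (hd : Module.finrank ℝ W = Module.finrank ℝ V + 2)
    (hc : ∀ z ∈ U, ⟪F z, u⟫ = c) (hy : y ∈ U) : u = c • F y + ⟪N y, u⟫ • N y := by
  have h1 := ((h.hasFDerivAt hy).inner ℝ (hasFDerivAt_const u y)).eq_of_eqOn
    (hasFDerivAt_const c y) h.isOpen hy hc
  have h2 (x : V) : ⟪fderiv ℝ F y x, u⟫ = 0 := by
    simpa [fderivInnerCLM_apply] using DFunLike.congr_fun h1 x
  have h3 := h.fderiv_tangentPart hy hd u
  have h4 : fderiv ℝ F y (tangentPart F N y u) = 0 := by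
    rw [← inner_self_eq_zero (𝕜 := ℝ)]
    nth_rewrite 2 [h3]
    rw [inner_sub_right, inner_sub_right, inner_smul_right, inner_smul_right, h2,
      real_inner_comm (F y), real_inner_comm (N y), h.inner_fderiv hy, h.inner_normal_fderiv y hy]
    simp
  rw [h4, hc y hy] at h3
  rw [eq_comm, sub_sub, sub_eq_zero] at h3
  exact h3

end IsHypersurfacePatch

section Riemannian

variable {n : ℕ} {M : Type*} [MetricSpace M] [ChartedSpace (EuclideanSpace ℝ (Fin n)) M]
  [Bundle.RiemannianBundle (fun x : M ↦ TangentSpace (𝓡 n) x)]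
  [IsRiemannianManifold (𝓡 n) M] [IsManifold (𝓡 n) ∞ M] [CompleteSpace M]
variable {φ : M → UnitSphere n} {ν : M → Ambient n}

/-- If the components of `φ` and `ν` in `E` are parallel, then a complete hypersurface is invariant
under the rotations of `E`. -/
theorem isRotationInvariant_range_position
    (hφ : ContMDiff (𝓡 n) 𝓘(ℝ, Ambient n) ∞ (position φ))
    (hmetric : ∀ (x : M) (w z : TangentSpace (𝓡 n) x),
      ⟪w, z⟫ = ⟪dPosition φ x w, dPosition φ x z⟫)
    (hinj : ∀ x, Function.Injective (dPosition φ x)) (hν : IsGaussMap φ ν)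
    {E : Submodule ℝ (Ambient n)} (hE : ∀ x, ∃ s : ℝ, ν x - s • position φ x ∈ Eᗮ) :
    IsRotationInvariant (Set.range (position φ)) E := by
  rintro a ha b hb y hy hab hn ⟨x, hx⟩ t ht
  by_cases ha0 : a = 0
  · subst ha0
    rw [norm_zero, eq_comm, norm_eq_zero] at hn
    subst hn
    exact ⟨x, by simpa using hx⟩
  have hna : ‖a‖ ^ 2 ≠ 0 := by
    have := norm_ne_zero_iff.2 ha0
    positivity
  set K : Ambient n →L[ℝ] Ambient n := (‖a‖ ^ 2)⁻¹ •
    ((innerSL ℝ a).smulRight b - (innerSL ℝ b).smulRight a) with hKdef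
  have hKw (w : Ambient n) : K w = (‖a‖ ^ 2)⁻¹ • (⟪a, w⟫ • b - ⟪b, w⟫ • a) := by
    simp [hKdef]
  have hK (w : Ambient n) : ⟪w, K w⟫ = 0 := by
    rw [hKw, inner_smul_right, inner_sub_right, inner_smul_right, inner_smul_right,
      real_inner_comm a, real_inner_comm b]
    ring
  have hKE (w : Ambient n) : K w ∈ E := by
    rw [hKw]
    exact E.smul_mem _ (E.sub_mem (E.smul_mem _ hb) (E.smul_mem _ ha))
  have hKν (x : M) : ⟪ν x, K (position φ x)⟫ = 0 := by
    obtain ⟨s, hs⟩ := hE x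
    have h1 := (Submodule.mem_orthogonal' E _).1 hs _ (hKE (position φ x))
    rw [inner_sub_left, inner_smul_left, hK, mul_zero, sub_zero] at h1
    exact h1
  have hay : ⟪a, y⟫ = 0 := (Submodule.mem_orthogonal E y).1 hy a ha
  have hby : ⟪b, y⟫ = 0 := (Submodule.mem_orthogonal E y).1 hy b hb
  have hba : ⟪b, a⟫ = 0 := by rw [real_inner_comm, hab]
  have hp (t : ℝ) : HasDerivAt (fun t ↦ Real.cos t • a + Real.sin t • b + y)
      (K (Real.cos t • a + Real.sin t • b + y)) t := by
    have h1 := (((Real.hasDerivAt_cos t).smul_const a).add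
      ((Real.hasDerivAt_sin t).smul_const b)).add_const y
    convert! h1 using 1
    rw [hKw, inv_smul_eq_iff₀ hna]
    simp only [inner_add_right, inner_smul_right, hab, hba, hay, hby, real_inner_self_eq_norm_sq,
      ← hn]
    module
  obtain ⟨z, hz⟩ := exists_position_eq_of_hasDerivAt hφ hmetric hinj hν K hK hKν hp ht (x := x)
    (by simpa using hx)
  exact ⟨z, hz⟩

theorem isUmbilicalSphere_of_inner_eq [Nonempty M] (hn : 1 ≤ n)
    (hφ : ContMDiff (𝓡 n) 𝓘(ℝ, Ambient n) ∞ (position φ))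
    (hmetric : ∀ (x : M) (w z : TangentSpace (𝓡 n) x),
      ⟪w, z⟫ = ⟪dPosition φ x w, dPosition φ x z⟫)
    (hinj : ∀ x, Function.Injective (dPosition φ x)) (hν : IsGaussMap φ ν)
    {u : Ambient n} {c : ℝ} (hu : ‖u‖ = 1) (hc : ∀ x, ⟪position φ x, u⟫ = c) :
    IsUmbilicalSphere (Set.range φ) := by
  have : Nonempty (Fin n) := ⟨⟨0, hn⟩⟩
  have hc1 : |c| < 1 := by
    obtain ⟨x⟩ := ‹Nonempty M›
    exact (isHypersurfacePatch_chartRep hφ hinj hν x).abs_lt_one_of_inner_eq hu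
      (fun z _ ↦ hc _) (mem_extChartAt_target x)
  have hu0 : u ≠ 0 := by
    rintro rfl
    simp at hu
  have hrot : IsRotationInvariant (Set.range (position φ)) (ℝ ∙ u)ᗮ := by
    refine isRotationInvariant_range_position hφ hmetric hinj hν (fun x ↦ ?_)
    have h1 := (isHypersurfacePatch_chartRep hφ hinj hν x).eq_of_inner_eq finrank_ambient
      (fun z _ ↦ hc _) (mem_extChartAt_target x)
    simp only [chartRep, Function.comp_apply, extChartAt_to_inv] at h1
    have hd : ⟪ν x, u⟫ ≠ 0 := by
      intro h0
      rw [h0, zero_smul, add_zero] at h1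
      have h2 := congrArg norm h1
      rw [norm_smul, hu, show ‖position φ x‖ = 1 from norm_eq_of_mem_sphere (φ x), mul_one,
        Real.norm_eq_abs] at h2
      exact hc1.ne h2.symm
    refine ⟨-(c / ⟪ν x, u⟫), ?_⟩
    rw [Submodule.orthogonal_orthogonal, Submodule.mem_span_singleton]
    refine ⟨⟪ν x, u⟫⁻¹, ?_⟩
    rw [inv_smul_eq_iff₀ hd, smul_sub, smul_smul, mul_neg, mul_div_cancel₀ _ hd]
    conv_lhs => rw [h1]
    module
  have hdim : 2 ≤ Module.finrank ℝ (ℝ ∙ u)ᗮ := by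
    have h1 := Submodule.finrank_add_finrank_orthogonal (ℝ ∙ u)
    rw [finrank_span_singleton hu0] at h1
    simp at h1
    omega
  have huu : ⟪u, u⟫ = 1 := by rw [real_inner_self_eq_norm_sq, hu, one_pow]
  have hmem (q : Ambient n) (hq : ⟪q, u⟫ = c) : q - c • u ∈ (ℝ ∙ u)ᗮ := by
    rw [Submodule.mem_orthogonal_singleton_iff_inner_right, inner_sub_right, inner_smul_right, huu,
      real_inner_comm, hq]
    ring
  have hnorm (q : Ambient n) (hq : ⟪q, u⟫ = c) (hq1 : ‖q‖ = 1) : ‖q - c • u‖ ^ 2 = 1 - c ^ 2 := by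
    rw [norm_sub_sq_real, inner_smul_right, hq, norm_smul, hq1, hu, Real.norm_eq_abs, mul_one,
      sq_abs]
    ring
  refine ⟨u, c, hu, hc1, Set.Subset.antisymm ?_ ?_⟩
  · rintro _ ⟨x, rfl⟩
    exact hc x
  · intro q hq
    obtain ⟨x⟩ := ‹Nonempty M›
    have hq' : ⟪(q : Ambient n), u⟫ = c := hq
    have hy : c • u ∈ (ℝ ∙ u)ᗮᗮ := by
      rw [Submodule.orthogonal_orthogonal]
      exact Submodule.smul_mem _ _ (Submodule.mem_span_singleton_self u)
    obtain ⟨z, hz⟩ := hrot.mem_of_norm_eq hdim (hmem _ (hc x)) (hmem _ hq') hy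
      ((sq_eq_sq₀ (norm_nonneg _) (norm_nonneg _)).1
        ((hnorm _ (hc x) (norm_eq_of_mem_sphere (φ x))).trans
          (hnorm _ hq' (norm_eq_of_mem_sphere q)).symm)) ⟨x, by abel⟩
    exact ⟨z, Subtype.ext (hz.trans (by abel))⟩

end Riemannian

/-- A linear isometry which maps the subspace of the first `k + 1` coordinates to `E`. -/
theorem exists_linearIsometryEquiv_sum_sq_eq {m k : ℕ} {E : Submodule ℝ (EuclideanSpace ℝ (Fin m))}
    (hE : Module.finrank ℝ E = k + 1) :
    ∃ g : EuclideanSpace ℝ (Fin m) ≃ₗᵢ[ℝ] EuclideanSpace ℝ (Fin m),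
      ∀ p, ∀ a ∈ E, ∀ y ∈ Eᗮ, g p = a + y →
        (∑ i : Fin m with i.val < k + 1, p i ^ 2) = ‖a‖ ^ 2 ∧
          (∑ i : Fin m with k + 1 ≤ i.val, p i ^ 2) = ‖y‖ ^ 2 := by
  let bE : OrthonormalBasis (Fin (k + 1)) ℝ E :=
    (stdOrthonormalBasis ℝ E).reindex (finCongr hE)
  let s : Set (Fin m) := {i | i.val < k + 1}
  let v : Fin m → EuclideanSpace ℝ (Fin m) := fun i ↦
    if h : i.val < k + 1 then (bE ⟨i.val, h⟩ : EuclideanSpace ℝ (Fin m)) else 0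
  have hv : Orthonormal ℝ (s.domRestrict v) := by
    have h1 : s.domRestrict v = E.subtypeₗᵢ ∘ bE ∘ fun i : s ↦ ⟨i.1.val, i.2⟩ := by
      ext1 i
      exact dif_pos i.2
    rw [h1]
    refine (bE.orthonormal.comp _ ?_).comp_linearIsometry _
    intro i j hij
    exact Subtype.ext (Fin.ext (Fin.mk.inj_iff.1 hij))
  obtain ⟨b, hb⟩ := hv.exists_orthonormalBasis_extension_of_card_eq (by simp)
  have hbE (i : Fin m) (hi : i.val < k + 1) : b i = bE ⟨i.val, hi⟩ := by
    rw [hb i hi]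
    exact dif_pos hi
  have hkm : k + 1 ≤ m := by
    have := Submodule.finrank_le E
    simpa [hE] using this
  have hbE' (i : Fin m) (hi : k + 1 ≤ i.val) : b i ∈ Eᗮ := by
    rw [Submodule.mem_orthogonal]
    intro e he
    have h1 : ((∑ j, ⟪bE j, (⟨e, he⟩ : E)⟫ • bE j : E) : EuclideanSpace ℝ (Fin m)) = e := by
      rw [bE.sum_repr']
    rw [← h1, Submodule.coe_sum, sum_inner]
    refine Finset.sum_eq_zero (fun j _ ↦ ?_)
    have h2 := hbE ⟨j.val, j.2.trans_le hkm⟩ j.2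
    rw [Submodule.coe_smul, inner_smul_left, ← h2, b.orthonormal.2, mul_zero]
    intro h3
    have := congrArg Fin.val h3
    simp at this
    omega
  refine ⟨b.repr.symm, fun p a ha y hy hp ↦ ?_⟩
  have hpi (i : Fin m) : p i = ⟪b i, a⟫ + ⟪b i, y⟫ := by
    rw [← inner_add_right, ← hp, ← b.repr_apply_apply, LinearIsometryEquiv.apply_symm_apply]
  have hlt (i : Fin m) (hi : i.val < k + 1) : ⟪b i, y⟫ = 0 := by
    rw [hbE i hi]
    exact (Submodule.mem_orthogonal E y).1 hy _ (bE _).2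
  have hge (i : Fin m) (hi : k + 1 ≤ i.val) : ⟪b i, a⟫ = 0 :=
    (Submodule.mem_orthogonal' E _).1 (hbE' i hi) a ha
  have hnorm (x : EuclideanSpace ℝ (Fin m)) : ∑ i, ⟪b i, x⟫ ^ 2 = ‖x‖ ^ 2 := by
    rw [← b.sum_sq_norm_inner_right x]
    simp
  constructor
  · rw [← hnorm, Finset.sum_filter]
    refine Finset.sum_congr rfl (fun i _ ↦ ?_)
    split_ifs with hi
    · rw [hpi, hlt i hi, add_zero]
    · rw [hge i (not_lt.1 hi)]
      simp
  · rw [← hnorm, Finset.sum_filter]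
    refine Finset.sum_congr rfl (fun i _ ↦ ?_)
    split_ifs with hi
    · rw [hpi, hge i hi, zero_add]
    · rw [hlt i (not_le.1 hi)]
      simp

theorem isCliffordHypersurface_of_isRotationInvariant {n : ℕ} {S : Set (UnitSphere n)}
    (hS : S.Nonempty) {E : Submodule ℝ (Ambient n)} (hE : 2 ≤ Module.finrank ℝ E)
    (hE' : 2 ≤ Module.finrank ℝ Eᗮ) {r : ℝ} (hr0 : 0 < r) (hr1 : r < 1)
    (hSE : ∀ p ∈ S, ∃ a ∈ E, ∃ y ∈ Eᗮ, (p : Ambient n) = a + y ∧ ‖a‖ ^ 2 = r ^ 2)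
    (h : IsRotationInvariant (Subtype.val '' S) E) (h' : IsRotationInvariant (Subtype.val '' S) Eᗮ) :
    IsCliffordHypersurface S := by
  obtain ⟨k, hk⟩ : ∃ k, Module.finrank ℝ E = k + 1 := ⟨Module.finrank ℝ E - 1, by omega⟩
  have hdim := Submodule.finrank_add_finrank_orthogonal E
  rw [finrank_euclideanSpace_fin] at hdim
  obtain ⟨g, hg⟩ := exists_linearIsometryEquiv_sum_sq_eq hk
  have hpyth {a y : Ambient n} (ha : a ∈ E) (hy : y ∈ Eᗮ) : ‖a + y‖ ^ 2 = ‖a‖ ^ 2 + ‖y‖ ^ 2 := by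
    rw [norm_add_sq_real, (Submodule.mem_orthogonal E y).1 hy a ha]
    ring
  have hsphere (p : UnitSphere n) : ‖(p : Ambient n)‖ = 1 := norm_eq_of_mem_sphere p
  refine ⟨k, r, g, by omega, by omega, hr0, hr1, Set.Subset.antisymm ?_ ?_⟩
  · rintro _ ⟨p, hp, rfl⟩
    obtain ⟨a, ha, y, hy, hpay, har⟩ := hSE p hp
    have h1 := hpyth ha hy
    rw [← hpay, hsphere, har] at h1
    obtain ⟨h2, h3⟩ := hg (g.symm p) a ha y hy (by rw [g.apply_symm_apply, hpay])
    refine ⟨g.symm p, ⟨⟨g.symm p, ?_⟩, ⟨?_, ?_⟩, rfl⟩, g.apply_symm_apply _⟩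
    · rw [mem_sphere_zero_iff_norm, g.symm.norm_map, hsphere]
    · rw [← har]; exact h2
    · rw [show 1 - r ^ 2 = ‖y‖ ^ 2 by linarith]; exact h3
  · rintro _ ⟨_, ⟨q, ⟨hq1, hq2⟩, rfl⟩, rfl⟩
    obtain ⟨p, hp⟩ := hS
    obtain ⟨a, ha, y, hy, hpay, har⟩ := hSE p hp
    obtain ⟨a', ha', y', hy', hq⟩ := E.exists_add_mem_mem_orthogonal (g q)
    obtain ⟨h2, h3⟩ := hg q a' ha' y' hy' hq
    have h1 := hpyth ha hy
    rw [← hpay, hsphere, har] at h1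
    have haa' : ‖a‖ = ‖a'‖ := by
      rw [← sq_eq_sq₀ (norm_nonneg _) (norm_nonneg _), har, ← h2, hq1]
    have hyy' : ‖y‖ = ‖y'‖ := by
      rw [← sq_eq_sq₀ (norm_nonneg _) (norm_nonneg _), ← h3, hq2]
      linarith
    obtain ⟨p', hp', hpe⟩ := h.mem_of_norm_eq hE ha ha' hy haa' (hpay ▸ ⟨p, hp, rfl⟩)
    obtain ⟨p'', hp'', hpe'⟩ := h'.mem_of_norm_eq hE' hy hy' (E.le_orthogonal_orthogonal ha') hyy'
      ⟨p', hp', hpe.trans (add_comm _ _)⟩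
    exact ⟨p'', hp'', (hpe'.trans (add_comm _ _)).trans hq.symm⟩

section Riemannian

variable {n : ℕ} {M : Type*} [MetricSpace M] [ChartedSpace (EuclideanSpace ℝ (Fin n)) M]
  [Bundle.RiemannianBundle (fun x : M ↦ TangentSpace (𝓡 n) x)]
  [IsRiemannianManifold (𝓡 n) M] [IsManifold (𝓡 n) ∞ M] [CompleteSpace M]
  [ConnectedSpace M]
variable {φ : M → UnitSphere n} {ν : M → Ambient n}

/-- If the component of `φ` in a line has constant length, then `φ` parametrizes an umbilical
sphere. -/
theorem isUmbilicalSphere_of_finrank_eq_one (hn : 1 ≤ n)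
    (hφ : ContMDiff (𝓡 n) 𝓘(ℝ, Ambient n) ∞ (position φ))
    (hmetric : ∀ (x : M) (w z : TangentSpace (𝓡 n) x),
      ⟪w, z⟫ = ⟪dPosition φ x w, dPosition φ x z⟫)
    (hinj : ∀ x, Function.Injective (dPosition φ x)) (hν : IsGaussMap φ ν)
    {E : Submodule ℝ (Ambient n)} (hE : Module.finrank ℝ E = 1) {K : ℝ} (hK : K ≠ 0)
    (h : ∀ x, ∃ a ∈ E, ∃ y ∈ Eᗮ, position φ x = a + y ∧ ‖a‖ ^ 2 = K) :
    IsUmbilicalSphere (Set.range φ) := by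
  obtain ⟨u, hu⟩ : ∃ u : E, ‖u‖ = 1 := by
    have : Nontrivial E := Module.nontrivial_of_finrank_pos (R := ℝ) (by omega)
    exact exists_norm_eq E zero_le_one
  have hu0 : u ≠ 0 := by
    rintro rfl
    simp at hu
  have hu1 : ‖(u : Ambient n)‖ = 1 := hu
  have hsq (x : M) : ⟪position φ x, (u : Ambient n)⟫ ^ 2 = K := by
    obtain ⟨a, ha, y, hy, hay, haK⟩ := h x
    obtain ⟨s, hs⟩ := (finrank_eq_one_iff_of_nonzero' u hu0).1 hE ⟨a, ha⟩
    have hs' : s • (u : Ambient n) = a := congrArg Subtype.val hs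
    rw [hay, inner_add_left, (Submodule.mem_orthogonal' E y).1 hy u u.2, ← hs', inner_smul_left,
      real_inner_self_eq_norm_sq, hu1, ← haK, ← hs', norm_smul, hu1]
    simp
  have hcont : Continuous fun x ↦ ⟪position φ x, (u : Ambient n)⟫ :=
    hφ.continuous.inner continuous_const
  obtain ⟨x₀⟩ := ‹ConnectedSpace M›.toNonempty
  set c := ⟪position φ x₀, (u : Ambient n)⟫ with hc
  have hc0 : c ≠ 0 := by
    intro h0
    apply hK
    rw [← hsq x₀, ← hc, h0]
    ring
  have heq : Set.EqOn (fun x ↦ ⟪position φ x, (u : Ambient n)⟫) (fun _ ↦ c) Set.univ := by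
    refine isPreconnected_univ.eq_of_sq_eq hcont.continuousOn continuousOn_const
      (fun x _ ↦ ?_) (fun _ ↦ hc0) (Set.mem_univ x₀) rfl
    simp only [Pi.pow_apply]
    rw [hsq, ← hsq x₀]
  exact isUmbilicalSphere_of_inner_eq hn hφ hmetric hinj hν hu1 (fun x ↦ heq (Set.mem_univ x))

theorem isUmbilicalSphere_or_isCliffordHypersurface (hn : 1 ≤ n)
    (hφ : ContMDiff (𝓡 n) 𝓘(ℝ, Ambient n) ∞ (position φ))
    (hmetric : ∀ (x : M) (w z : TangentSpace (𝓡 n) x),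
      ⟪w, z⟫ = ⟪dPosition φ x w, dPosition φ x z⟫)
    (hinj : ∀ x, Function.Injective (dPosition φ x)) (hν : IsGaussMap φ ν)
    {E : Submodule ℝ (Ambient n)} {μ : ℝ} (hμ : μ ≠ 0)
    (h1 : ∀ x, μ • position φ x - ν x ∈ E) (h2 : ∀ x, position φ x + μ • ν x ∈ Eᗮ) :
    IsUmbilicalSphere (Set.range φ) ∨ IsCliffordHypersurface (Set.range φ) := by
  have h0 : (1 + μ ^ 2) ≠ 0 := by positivity
  have hφ1 (x : M) : ‖position φ x‖ = 1 := norm_eq_of_mem_sphere (φ x)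
  have hνφ (x : M) : ⟪position φ x, ν x⟫ = 0 := by rw [real_inner_comm, hν.inner_position]
  have hdec (x : M) : position φ x = (1 + μ ^ 2)⁻¹ • μ • (μ • position φ x - ν x) +
      (1 + μ ^ 2)⁻¹ • (position φ x + μ • ν x) := by
    rw [← smul_add, eq_inv_smul_iff₀ h0]
    module
  have hnη (x : M) : ‖(1 + μ ^ 2)⁻¹ • μ • (μ • position φ x - ν x)‖ ^ 2 = μ ^ 2 / (1 + μ ^ 2) := by
    rw [norm_smul, norm_smul, mul_pow, mul_pow, norm_sub_sq_real, norm_smul, inner_smul_left, hνφ,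
      hφ1, hν.norm_eq_one, Real.norm_eq_abs, Real.norm_eq_abs, mul_one, sq_abs, sq_abs]
    field_simp
    simp
    ring
  have hnζ (x : M) : ‖(1 + μ ^ 2)⁻¹ • (position φ x + μ • ν x)‖ ^ 2 = 1 / (1 + μ ^ 2) := by
    rw [norm_smul, mul_pow, norm_add_sq_real, norm_smul, inner_smul_right, hνφ,
      hφ1, hν.norm_eq_one, Real.norm_eq_abs, Real.norm_eq_abs, mul_one, sq_abs, sq_abs]
    field_simp
    simp
  have hmη (x : M) := E.smul_mem (1 + μ ^ 2)⁻¹ (E.smul_mem μ (h1 x))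
  have hmζ (x : M) := Eᗮ.smul_mem (1 + μ ^ 2)⁻¹ (h2 x)
  obtain ⟨x₀⟩ := ‹ConnectedSpace M›.toNonempty
  have hE0 : Module.finrank ℝ E ≠ 0 := by
    intro hE
    rw [Submodule.finrank_eq_zero] at hE
    have h3 := hmη x₀
    rw [hE, Submodule.mem_bot] at h3
    have h4 := hnη x₀
    rw [h3, norm_zero] at h4
    have : 0 < μ ^ 2 / (1 + μ ^ 2) := by positivity
    linarith
  have hE0' : Module.finrank ℝ Eᗮ ≠ 0 := by
    intro hE
    rw [Submodule.finrank_eq_zero] at hE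
    have h3 := hmζ x₀
    rw [hE, Submodule.mem_bot] at h3
    have h4 := hnζ x₀
    rw [h3, norm_zero] at h4
    have : 0 < 1 / (1 + μ ^ 2) := by positivity
    linarith
  by_cases hE1 : Module.finrank ℝ E = 1
  · exact Or.inl (isUmbilicalSphere_of_finrank_eq_one hn hφ hmetric hinj hν hE1 (by positivity)
      (fun x ↦ ⟨_, hmη x, _, hmζ x, hdec x, hnη x⟩))
  by_cases hE1' : Module.finrank ℝ Eᗮ = 1
  · exact Or.inl (isUmbilicalSphere_of_finrank_eq_one hn hφ hmetric hinj hν hE1' (by positivity)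
      (fun x ↦ ⟨_, hmζ x, _, E.le_orthogonal_orthogonal (hmη x), (hdec x).trans (add_comm _ _),
        hnζ x⟩))
  have hrange : (Subtype.val '' Set.range φ : Set (Ambient n)) = Set.range (position φ) :=
    (Set.range_comp _ _).symm
  have hr : μ ^ 2 / (1 + μ ^ 2) = √(μ ^ 2 / (1 + μ ^ 2)) ^ 2 := (Real.sq_sqrt (by positivity)).symm
  refine Or.inr (isCliffordHypersurface_of_isRotationInvariant (Set.range_nonempty φ)
    (E := E) (by omega) (by omega) (r := √(μ ^ 2 / (1 + μ ^ 2))) (by positivity) ?_ ?_ ?_ ?_)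
  · rw [Real.sqrt_lt' one_pos, div_lt_iff₀ (by positivity)]
    linarith
  · rintro _ ⟨x, rfl⟩
    exact ⟨_, hmη x, _, hmζ x, hdec x, (hnη x).trans hr⟩
  · rw [hrange]
    refine isRotationInvariant_range_position hφ hmetric hinj hν (fun x ↦ ⟨-μ⁻¹, ?_⟩)
    convert! Eᗮ.smul_mem μ⁻¹ (h2 x) using 1
    rw [smul_add, smul_smul, inv_mul_cancel₀ hμ]
    module
  · rw [hrange]
    refine isRotationInvariant_range_position hφ hmetric hinj hν (fun x ↦ ⟨μ, ?_⟩)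
    rw [← neg_sub]
    exact E.le_orthogonal_orthogonal (E.neg_mem (h1 x))

end Riemannian

section Chart

variable {n : ℕ} {M : Type*} [TopologicalSpace M] [ChartedSpace (EuclideanSpace ℝ (Fin n)) M]
  [IsManifold (𝓡 n) ∞ M]
variable {φ : M → UnitSphere n} {ν : M → Ambient n}

/-- The span of the focal map `μ φ - ν` and its differential. -/
noncomputable def focalSubspace (φ : M → UnitSphere n) (ν : M → Ambient n) (μ : ℝ) (x : M) :
    Submodule ℝ (Ambient n) :=
  ℝ ∙ (μ • position φ x - ν x) ⊔
    (mvfderiv (𝓡 n) (fun x ↦ μ • position φ x - ν x) x).toLinearMap.range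

theorem focalSpace_chartRep (hφ : ContMDiff (𝓡 n) 𝓘(ℝ, Ambient n) ∞ (position φ))
    (hν : IsGaussMap φ ν) (μ : ℝ) (x₀ : M) {y : EuclideanSpace ℝ (Fin n)}
    (hy : y ∈ (extChartAt (𝓡 n) x₀).target) :
    IsHypersurfacePatch.focalSpace (chartRep (position φ) x₀) (chartRep ν x₀) μ y =
      focalSubspace φ ν μ ((extChartAt (𝓡 n) x₀).symm y) := by
  obtain ⟨T, hT⟩ := exists_equiv_fderiv_comp_extChartAt_symm (W := Ambient n) x₀ hy
  have hf : MDifferentiableAt (𝓡 n) 𝓘(ℝ, Ambient n) (fun x ↦ μ • position φ x - ν x)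
      ((extChartAt (𝓡 n) x₀).symm y) :=
    (((hφ _).mdifferentiableAt (by simp)).const_smul μ).sub
      ((hν.smooth _).mdifferentiableAt (by simp))
  refine congrArg₂ (· ⊔ ·) rfl (Submodule.ext fun w ↦ ⟨?_, ?_⟩)
  · rintro ⟨a, rfl⟩
    exact ⟨T a, (hT _ hf a).symm⟩
  · rintro ⟨a, rfl⟩
    refine ⟨T.symm a, (hT _ hf _).trans ?_⟩
    rw [T.apply_symm_apply]
    rfl

/-- If `-μ` and `1 / μ` are the only principal curvatures, then the focal subspace is constant. -/
theorem focalSubspace_eq [PreconnectedSpace M]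
    (hφ : ContMDiff (𝓡 n) 𝓘(ℝ, Ambient n) ∞ (position φ))
    (hinj : ∀ x, Function.Injective (dPosition φ x)) (hν : IsGaussMap φ ν) {μ : ℝ}
    (hS : ∀ x₀ : M, ∀ y ∈ (extChartAt (𝓡 n) x₀).target,
      (IsHypersurfacePatch.shape (chartRep (position φ) x₀) (chartRep ν x₀) y + μ • 1) *
        (1 - μ • IsHypersurfacePatch.shape (chartRep (position φ) x₀) (chartRep ν x₀) y) = 0)
    (x x' : M) : focalSubspace φ ν μ x = focalSubspace φ ν μ x' := by
  refine IsLocallyConstant.apply_eq_of_preconnectedSpace ?_ x x'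
  rw [IsLocallyConstant.iff_eventually_eq]
  intro x₀
  set e := extChartAt (𝓡 n) x₀
  have h := isHypersurfacePatch_chartRep hφ hinj hν x₀
  obtain ⟨δ, hδ, hsub⟩ := Metric.isOpen_iff.1 h.isOpen _ (mem_extChartAt_target x₀)
  have h' : IsHypersurfacePatch (chartRep (position φ) x₀) (chartRep ν x₀)
      (Metric.ball (e x₀) δ) :=
    ⟨Metric.isOpen_ball, h.contDiffOn.mono hsub, h.contDiffOn_normal.mono hsub,
      fun y hy ↦ h.norm_eq_one y (hsub hy), fun y hy ↦ h.norm_normal y (hsub hy),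
      fun y hy ↦ h.inner_normal y (hsub hy), fun y hy ↦ h.inner_normal_fderiv y (hsub hy),
      fun y hy ↦ h.injective_fderiv y (hsub hy)⟩
  filter_upwards [(continuousAt_extChartAt (I := 𝓡 n) x₀).preimage_mem_nhds (Metric.ball_mem_nhds (e x₀) hδ),
    extChartAt_source_mem_nhds (I := 𝓡 n) x₀] with z hz hzs
  have h1 := h'.focalSpace_eq finrank_ambient (fun y hy ↦ hS x₀ y (hsub hy))
    (convex_ball (e x₀) δ).isPreconnected hz (Metric.mem_ball_self (x := e x₀) hδ)
  rwa [focalSpace_chartRep hφ hν μ x₀ (hsub hz), focalSpace_chartRep hφ hν μ x₀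
    (mem_extChartAt_target x₀), e.left_inv hzs, extChartAt_to_inv] at h1

end Chart

theorem theorem1p1 {n : ℕ} (hn : 1 ≤ n)
    -- a connected complete smooth Riemannian manifold of dimension `n`
    {M : Type*} [MetricSpace M] [ConnectedSpace M] [CompleteSpace M]
    [ChartedSpace (EuclideanSpace ℝ (Fin n)) M] [IsManifold (𝓡 n) ∞ M]
    [Bundle.RiemannianBundle (fun x : M ↦ TangentSpace (𝓡 n) x)]
    [IsContMDiffRiemannianBundle (𝓡 n) ∞ (EuclideanSpace ℝ (Fin n))
      (fun x : M ↦ TangentSpace (𝓡 n) x)]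
    [IsRiemannianManifold (𝓡 n) M]
    -- an immersion into the sphere, whose induced metric is the metric of `M`
    (φ : M → UnitSphere n) (hφ : Manifold.IsImmersion (𝓡 n) (𝓡 (n + 1)) ∞ φ)
    (hmetric : ∀ (x : M) (w z : TangentSpace (𝓡 n) x),
      ⟪w, z⟫ = ⟪dPosition φ x w, dPosition φ x z⟫)
    -- the Gauss map given by the orientation, and constant mean curvature
    (ν : M → Ambient n) (hν : IsGaussMap φ ν)
    (hH : ∃ H : ℝ, ∀ x, meanCurvature φ ν x = H)
    -- the relation `ℓ_v = λ f_v`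
    (v : Ambient n) (hv : v ≠ 0) (lam : ℝ)
    (hrel : ∀ x, ⟪position φ x, v⟫ = lam * ⟪ν x, v⟫) :
    IsUmbilicalSphere (Set.range φ) ∨ IsCliffordHypersurface (Set.range φ) := by
  have hφs : ContMDiff (𝓡 n) 𝓘(ℝ, Ambient n) ∞ (position φ) := by
    obtain ⟨_, _, _, h⟩ := hφ
    exact contMDiff_coe_sphere.comp h.contMDiff
  have hinj (x : M) : Function.Injective (dPosition φ x) := by
    rw [injective_iff_map_eq_zero]
    intro w hw
    have h1 := hmetric x w w
    rw [hw, inner_zero_left] at h1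
    exact inner_self_eq_zero.1 h1
  by_cases hlam : lam = 0
  · have hvn : ‖v‖ ≠ 0 := norm_ne_zero_iff.2 hv
    refine Or.inl (isUmbilicalSphere_of_inner_eq (u := ‖v‖⁻¹ • v) (c := 0) hn hφs hmetric hinj hν
      ?_ (fun x ↦ ?_))
    · rw [norm_smul, norm_inv, norm_norm, inv_mul_cancel₀ hvn]
    · rw [inner_smul_right, hrel, hlam, zero_mul, mul_zero]
  have hμ0 : lam⁻¹ ≠ 0 := inv_ne_zero hlam
  obtain ⟨H, hH⟩ := hH
  have hS : ∀ x₀ : M, ∀ y ∈ (extChartAt (𝓡 n) x₀).target,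
      (IsHypersurfacePatch.shape (chartRep (position φ) x₀) (chartRep ν x₀) y + lam⁻¹ • 1) *
        (1 - lam⁻¹ • IsHypersurfacePatch.shape (chartRep (position φ) x₀) (chartRep ν x₀) y) = 0 :=
    fun x₀ y hy ↦ (isHypersurfacePatch_chartRep hφs hinj hν x₀).shape_mul_eq_zero finrank_ambient hv
      hμ0 (fun z _ ↦ (eq_inv_mul_iff_mul_eq₀ hlam).2 (hrel _).symm)
      (fun z hz ↦ (trace_shape_chartRep hn hφs hinj hν x₀ hz).trans
        (congrArg ((n : ℝ) * ·) (hH _))) hy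
  obtain ⟨x₀⟩ := ‹ConnectedSpace M›.toNonempty
  refine isUmbilicalSphere_or_isCliffordHypersurface hn hφs hmetric hinj hν hμ0
    (E := focalSubspace φ ν lam⁻¹ x₀) (fun x ↦ ?_) (fun x ↦ ?_)
  · rw [focalSubspace_eq hφs hinj hν hS x₀ x]
    exact Submodule.mem_sup_left (Submodule.mem_span_singleton_self _)
  · have h := isHypersurfacePatch_chartRep hφs hinj hν x
    have hx := mem_extChartAt_target (I := 𝓡 n) x
    have h1 : IsHypersurfacePatch.cofocal (chartRep (position φ) x) (chartRep ν x) lam⁻¹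
        (extChartAt (𝓡 n) x x) = position φ x + lam⁻¹ • ν x := by
      simp [IsHypersurfacePatch.cofocal, chartRep]
    rw [focalSubspace_eq hφs hinj hν hS x₀ x, ← h1]
    have h2 := focalSpace_chartRep hφs hν lam⁻¹ x hx
    rw [extChartAt_to_inv] at h2
    rw [← h2, IsHypersurfacePatch.focalSpace, Submodule.mem_orthogonal]
    intro w hw
    obtain ⟨a, ha, _, ⟨b, rfl⟩, rfl⟩ := Submodule.mem_sup.1 hw
    obtain ⟨s, rfl⟩ := Submodule.mem_span_singleton.1 ha
    rw [inner_add_left, inner_smul_left, h.inner_focal_cofocal hx, real_inner_comm,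
      ContinuousLinearMap.coe_coe, h.fderiv_focal_apply finrank_ambient hx,
      h.inner_cofocal_fderiv hx]
    simp
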